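/- **Setting.** For an integer $N\ge 1$, a lower triangular matrix $H=[h_{k,j}]\in\mathbb{R}^{(N-1)\times(N-1)}$ defines the fixed-step algorithm $y_{k+1}=y_k-\sum_{j=0}^{k}h_{k+1,j+1}\,(y_j-\mathbb{T}y_j)$, $k=0,\dots,N-2$. Let $\mathcal{H}_\star(N-1)$ be the set of those $H$ for which $\|y_{N-1}-\mathbb{T}y_{N-1}\|^2\le \frac{4}{N^2}\|y_0-y_\star\|^2$ holds for every nonexpansive operator $\mathbb{T}$ on a real Hilbert space, every fixed point $y_\star$ of $\mathbb{T}$ and every starting point $y_0$. (For $N=1$ the only matrix is the empty one.) For $m\ge1$ put $$Q(m,j;H)=\sum_{j=j(1)\le i(1)<j(2)\le i(2)<\dots<j(m)\le i(m)\le N-1}\ \prod_{r=1}^m h_{i(r),j(r)} ,$$ and define the H-certificates of $H$ by $$\lambda^\star_{N,j}(H)=N\sum_{m=1}^{N-1}(-1)^{m-1}Q(m,j;H)\quad(1\le j\le N-1),$$ $$\lambda^\star_{k,j}(H)=N\sum_{\ell=1}^{N-1}\sum_{m=1}^{N-1}(-1)^{\ell+m-1}\binom{\ell+m}{m}Q(\ell,j;H)\,Q(m,k;H)\quad(1\le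 j<k\le N-1).$$ A *vertex* of $\mathcal{H}_\star(N-1)$ is an element lying on a maximal number of the zero sets of H-certificates, i.e. one with the smallest possible number of nonzero H-certificates. The diagram $\mathcal{G}(H)$ is the graph on nodes $1,\dots,N$ with an edge between $j<k$ exactly when $\lambda^\star_{k,j}(H)\neq 0$. An *arc diagram* on $N$ nodes is a graph on $1,\dots,N$ in which every node $j<N$ has exactly one edge to a larger node. For arc diagrams $\mathcal{G}_1,\mathcal{G}_2$ on $N'$ and $N-N'$ nodes, $\mathcal{G}_1\bowtie\mathcal{G}_2$ is the graph on $1,\dots,N$ obtained by placing $\mathcal{G}_2$, with its nodes relabeled $N'+1,\dots,N$, to the right of $\mathcal{G}_1$ and adding an edge between $N'$ and $N$. **Gluing.** Let $1\le N'\le N-1$, $H_1\in\mathcal{H}_\star(N'-1)$ and $H_2\in\mathcal{H}_\star(N-N'-1)$. The gluing $H_1\bowtie H_2$ is the lower triangular $(N-1)\times(N-1)$ matrix $H=[h_{k,j}]$ such that * its block of rows and columns $1,\dots,N'-1$ is $H_1$, its block of rows and columns $N'+1,\dots,N-1$ is $H_2$, and $h_{k,j}=0$ for $j<N'<k$; *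 $h_{N',j}=-\frac{N-N'}{N}\sum_{k=j}^{N'-1}(H_1)_{k,j}$ for $1\le j\le N'-1$, and $h_{N',N'}=\frac{N'(N-N')}{N}$; * $h_{N'+1,N'},\dots,h_{N-1,N'}$ are determined by $Q(k,N';H)=\frac{N'(N-N'+1)}{N(k+1)}\binom{N-N'-1}{k-1}$ for $k=1,\dots,N-N'$. **Theorem (Gluing theorem).** Let $1\le N'\le N-1$, $H_1\in\mathcal{H}_\star(N'-1)$ and $H_2\in\mathcal{H}_\star(N-N'-1)$. Then there is exactly one matrix $H_1\bowtie H_2$ as above, and $H_1\bowtie H_2\in\mathcal{H}_\star(N-1)$. Its H-certificates are, for $1\le j<k\le N$, $$\lambda^\star_{k,j}(H_1\bowtie H_2)=\begin{cases}\frac{N'}{N}\,\lambda^\star_{k,j}(H_1) & \text{if } k\le N',\\[2pt] \frac{N}{N-N'}\,\lambda^\star_{k-N',j-N'}(H_2) & \text{if } j\ge N'+1,\\[2pt] \frac{N'}{N-N'} & \text{if } (k,j)=(N,N'),\\[2pt] 0 & \text{otherwise.}\end{cases}$$ Moreover, if $H_1$ and $H_2$ are vertices of $\mathcal{H}_\star(N'-1)$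 and $\mathcal{H}_\star(N-N'-1)$, respectively, then $H_1\bowtie H_2$ is a vertex of $\mathcal{H}_\star(N-1)$, the graphs $\mathcal{G}(H_1)$, $\mathcal{G}(H_2)$ and $\mathcal{G}(H_1\bowtie H_2)$ are arc diagrams, and $\mathcal{G}(H_1\bowtie H_2)=\mathcal{G}(H_1)\bowtie\mathcal{G}(H_2)$. -/

import Mathlib

universe u

/-- Step-size matrices of algorithms that perform `N - 1` updates. -/
abbrev HMatrix (N : ℕ) : Type := Matrix (Fin (N - 1)) (Fin (N - 1)) ℝ

/-- The entry `h_{k,j}` with one-based indices `1 ≤ k, j ≤ N - 1` (and `0` outside this range). -/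
def ent (N : ℕ) (H : HMatrix N) (k j : ℕ) : ℝ :=
  if h : (1 ≤ k ∧ k ≤ N - 1) ∧ (1 ≤ j ∧ j ≤ N - 1) then
    H ⟨k - 1, by omega⟩ ⟨j - 1, by omega⟩
  else 0

def IsLowerTriangular {n : ℕ} (H : Matrix (Fin n) (Fin n) ℝ) : Prop :=
  ∀ i j : Fin n, i < j → H i j = 0

/-- `y 0, …, y (N - 1)` are generated from `y 0` by the fixed-step algorithm with matrix `H`:
`y_{k+1} = y_k - ∑_{j=0}^{k} h_{k+1,j+1} (y_j - T y_j)` for `k = 0, …, N - 2`. -/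
def IsTrajectory {X : Type u} [NormedAddCommGroup X] [InnerProductSpace ℝ X]
    (N : ℕ) (H : HMatrix N) (T : X → X) (y : ℕ → X) : Prop :=
  ∀ k : ℕ, k < N - 1 →
    y (k + 1) = y k - ∑ j ∈ Finset.range (k + 1), ent N H (k + 1) (j + 1) • (y j - T (y j))

/-- The set `𝓗⋆(N - 1)`: the lower triangular `(N-1) × (N-1)` matrices whose algorithm satisfies
`‖y_{N-1} - T y_{N-1}‖² ≤ 4 ‖y_0 - y⋆‖² / N²` for every nonexpansive operator `T` on a real
Hilbert space, every fixed point `y⋆` of `T` and every initial point `y_0`. -/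
def optimalHMatrices (N : ℕ) : Set (HMatrix N) :=
  {H | IsLowerTriangular H ∧
    ∀ (X : Type u) [NormedAddCommGroup X] [InnerProductSpace ℝ X] [CompleteSpace X]
      (T : X → X), (∀ x y : X, ‖T x - T y‖ ≤ ‖x - y‖) →
      ∀ yStar : X, T yStar = yStar →
      ∀ y : ℕ → X, IsTrajectory N H T y →
        ‖y (N - 1) - T (y (N - 1))‖ ^ 2 ≤ 4 * ‖y 0 - yStar‖ ^ 2 / (N : ℝ) ^ 2}

/-- The Q-function `Q(m, j; H)` (for `m ≥ 1`): the sum of `∏_{r=1}^{m} h_{i(r),j(r)}` over all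
`j = j(1) ≤ i(1) < j(2) ≤ i(2) < ⋯ < j(m) ≤ i(m) ≤ N - 1`. Here `p.1 = j(·)` and `p.2 = i(·)`,
with `r` running through `Fin m`. -/
noncomputable def qFun (N : ℕ) (H : HMatrix N) (m j : ℕ) : ℝ :=
  ∑ p ∈ (Fintype.piFinset (fun _ : Fin m => Finset.Icc 1 (N - 1)) ×ˢ
      Fintype.piFinset (fun _ : Fin m => Finset.Icc 1 (N - 1))) with
      ((∀ r : Fin m, (r : ℕ) = 0 → p.1 r = j) ∧
        (∀ r : Fin m, p.1 r ≤ p.2 r) ∧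
        (∀ r s : Fin m, (s : ℕ) = (r : ℕ) + 1 → p.2 r < p.1 s)),
    ∏ r : Fin m, ent N H (p.2 r) (p.1 r)

/-- The H-certificate `λ⋆_{k,j}(H)`, meaningful for `1 ≤ j < k ≤ N`. -/
noncomputable def cert (N : ℕ) (H : HMatrix N) (k j : ℕ) : ℝ :=
  if k = N then
    (N : ℝ) * ∑ m ∈ Finset.Icc 1 (N - 1), (-1 : ℝ) ^ (m - 1) * qFun N H m j
  else
    (N : ℝ) * ∑ l ∈ Finset.Icc 1 (N - 1), ∑ m ∈ Finset.Icc 1 (N - 1),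
      (-1 : ℝ) ^ (l + m - 1) * (Nat.choose (l + m) m : ℝ) * qFun N H l j * qFun N H m k

/-- The index pairs `(k, j)`, `1 ≤ j < k ≤ N`, at which the H-certificate does not vanish. -/
noncomputable def certSupport (N : ℕ) (H : HMatrix N) : Finset (ℕ × ℕ) :=
  open Classical in
  (Finset.Icc 1 N ×ˢ Finset.Icc 1 N).filter (fun p => p.2 < p.1 ∧ cert N H p.1 p.2 ≠ 0)

/-- Vertices of `𝓗⋆(N - 1)`: its elements lying on a maximal number of the zero sets of
H-certificates, that is, with the smallest possible number of nonzero H-certificates. -/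
def IsVertex (N : ℕ) (H : HMatrix N) : Prop :=
  H ∈ optimalHMatrices.{u} N ∧
    ∀ H' ∈ optimalHMatrices.{u} N, (certSupport N H).card ≤ (certSupport N H').card

/-- The (support graph of the) diagram of `H`. Nodes are labelled `1, …, N` in the text;
the element `i : Fin N` is the node with label `i + 1`. -/
def diagram (N : ℕ) (H : HMatrix N) : SimpleGraph (Fin N) :=
  SimpleGraph.fromRel (fun j k => j < k ∧ cert N H ((k : ℕ) + 1) ((j : ℕ) + 1) ≠ 0)

/-- Arc diagrams on `N` nodes: every node but the last has exactly one edge to a larger node. -/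
def IsArcDiagram {N : ℕ} (G : SimpleGraph (Fin N)) : Prop :=
  ∀ j : Fin N, (j : ℕ) + 1 < N → ∃! k : Fin N, j < k ∧ G.Adj j k

/-- Gluing of diagrams on `N'` and `N - N'` nodes: the second is placed to the right of the first
and an edge joins their rightmost nodes (labels `N'` and `N`). -/
def glueDiagram (N N' : ℕ) (G₁ : SimpleGraph (Fin N')) (G₂ : SimpleGraph (Fin (N - N'))) :
    SimpleGraph (Fin N) :=
  SimpleGraph.fromRel (fun u v =>
    (∃ a b : Fin N', G₁.Adj a b ∧ (u : ℕ) = a ∧ (v : ℕ) = b) ∨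
    (∃ a b : Fin (N - N'), G₂.Adj a b ∧ (u : ℕ) = N' + a ∧ (v : ℕ) = N' + b) ∨
    ((u : ℕ) + 1 = N' ∧ (v : ℕ) + 1 = N))

/-- `H` is a gluing `H₁ ⋈ H₂` of the `(N'-1) × (N'-1)` matrix `H₁` and the
`(N-N'-1) × (N-N'-1)` matrix `H₂`. -/
structure IsGluing (N N' : ℕ) (H₁ : HMatrix N') (H₂ : HMatrix (N - N')) (H : HMatrix N) :
    Prop where
  upper_left : ∀ k j : ℕ, 1 ≤ k → k ≤ N' - 1 → 1 ≤ j → j ≤ N' - 1 →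
    ent N H k j = ent N' H₁ k j
  upper_right : ∀ k j : ℕ, k ≤ N' → N' ≤ j → k < j → ent N H k j = 0
  lower_left : ∀ k j : ℕ, N' + 1 ≤ k → j ≤ N' - 1 → ent N H k j = 0
  lower_right : ∀ k j : ℕ, 1 ≤ k → k ≤ N - N' - 1 → 1 ≤ j → j ≤ N - N' - 1 →
    ent N H (N' + k) (N' + j) = ent (N - N') H₂ k j
  middle_row : ∀ j : ℕ, 1 ≤ j → j ≤ N' - 1 →
    ent N H N' j = -(((N : ℝ) - N') / N) * ∑ k ∈ Finset.Icc j (N' - 1), ent N' H₁ k j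
  middle_entry : ent N H N' N' = (N' : ℝ) * ((N : ℝ) - N') / N
  middle_column : ∀ k : ℕ, 1 ≤ k → k ≤ N - N' →
    qFun N H k N' =
      (N' : ℝ) * ((N : ℝ) - N' + 1) / ((N : ℝ) * ((k : ℝ) + 1)) *
        (Nat.choose (N - N' - 1) (k - 1) : ℝ)

/-- Gluing `λ₁ ⋈ λ₂` of H-certificates, for `1 ≤ j < k ≤ N`. -/
noncomputable def glueCert (N N' : ℕ) (lam₁ lam₂ : ℕ → ℕ → ℝ) (k j : ℕ) : ℝ :=
  if k ≤ N' then (N' : ℝ) / N * lam₁ k j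
  else if N' + 1 ≤ j then (N : ℝ) / ((N : ℝ) - N') * lam₂ (k - N') (j - N')
  else if k = N ∧ j = N' then (N' : ℝ) / ((N : ℝ) - N')
  else 0

/-!
For a step-size matrix `H` let `A = transfer N H` be the strictly lower triangular matrix with
`y_k = y_0 - ∑_j A_{k,j} g_j`, where `g_j = y_j - T y_j`, and let `e` be the last unit vector.
The Q-functions are the entries of the vectors `eᵀ A ^ m`, and by Pascal's rule the H-certificates
are `-N` times the entries below the diagonal of the unique solution `F = lyap A e N` of the Lyapunov
equation `F + Aᵀ F + F A = e eᵀ` (`cert_eq_lyap`, `lyap_equation`, `lyapunov_unique`). All assertions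
are proved through `F`.

Optimality is equivalent to the algebraic conditions `IsCertified`: `F 1 = e / N`, and the entries of
`F` below the diagonal are nonpositive.

* Sufficiency (`IsCertified.mem_optimal`): `energy_identity` writes
  `‖y_0 - y⋆‖² - N² ‖g_N‖² / 4` as a square plus a combination of the monotonicity expressions
  `⟪g_k - g_l, X_k - X_l⟫`, with `X = y - g / 2`, whose coefficients are those entries.
* Necessity of `F 1 = e / N`: along the signed cyclic shift `U` of `ℝ^N`, started at the sum of the
  basis vectors, the bound is attained for every method, whence `g_N = (2 / N) y_0`. Comparing this
  with the expansion of `g_N` in powers of `U - 1` gives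
  `∑_j Q(m, j; H) = C(N, m + 1) / N` (`observed_one_of_mem_optimal`).
* Necessity of the signs (`lyap_nonpos_of_mem_optimal`): all monotonicity expressions vanish along
  `U`. Folding the space along a hyperplane that almost contains all iterates but the `j`-th, and
  has the `k`-th one just on the other side, makes essentially only the expression for `(k, j)`
  positive, to first order. The square in the identity is of second order, so a coefficient of the
  wrong sign would violate the bound.

For a gluing, `A` is block lower triangular. Its off-diagonal block is explicit, since the prescribed
Q-functions determine the column of `A` at `N'` by observability of the second part
(`IsGluing.glueColumn_eq`); this also gives existence and uniqueness. The solution of the Lyapunov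
equation is written down and verified blockwise (`lyapunov_fromBlocks`, `IsGluing.lyap_eq`), which
yields both the certificates of the gluing and its optimality.

For an optimal matrix `F` is nonsingular, so every node but the last has a nonzero certificate to a
larger node (`exists_cert_ne_zero`). Hence there are at least `N - 1` nonzero certificates; repeated
gluing of single nodes attains this number. Vertices are therefore the optimal matrices with exactly
one such edge for each node, and gluing adds up these numbers, plus one for the new edge.
-/

section

open Matrix

/-! ### Two binomial identities -/

/-- The `n`-th finite difference of a polynomial of degree `m < n` vanishes. -/
theorem alternating_sum_choose_shift (n m s : ℕ) (h : m < n) :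
    ∑ l ∈ Finset.range (n + 1), (-1 : ℝ) ^ l * ((s + l).choose m : ℝ) * (n.choose l : ℝ) = 0 := by
  induction n generalizing m with
  | zero => omega
  | succ n ih =>
    have pascal : ∀ a : ℕ → ℝ, ∑ l ∈ Finset.range (n + 1 + 1), a l * ((n + 1).choose l : ℝ)
        = ∑ l ∈ Finset.range (n + 1), (a (l + 1) + a l) * (n.choose l : ℝ) := by
      intro a
      have h1 := Finset.sum_range_succ' (fun l => a l * (n.choose l : ℝ)) (n + 1)
      rw [Finset.sum_range_succ, Nat.choose_succ_self] at h1
      rw [Finset.sum_range_succ']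
      simp only [Nat.choose_succ_succ, Nat.cast_add, mul_add, add_mul, Finset.sum_add_distrib]
      simp only [Nat.cast_zero, mul_zero, add_zero, Nat.choose_zero_right, Nat.cast_one,
        mul_one] at h1 ⊢
      rw [h1, add_assoc]
    rw [pascal]
    rcases m with _ | m
    · simp [pow_succ]
    · have := ih m (by omega)
      rw [← neg_eq_zero, ← Finset.sum_neg_distrib] at this
      rw [← this]
      refine Finset.sum_congr rfl fun l _ => ?_
      rw [← add_assoc s l 1, Nat.choose_succ_succ]
      push_cast
      ring

theorem alternating_sum_choose_mul_choose (n m : ℕ) (h : m < n) :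
    ∑ l ∈ Finset.range n, (-1 : ℝ) ^ l * ((l + m).choose m : ℝ) * (n.choose (l + 1) : ℝ) =
      if m = 0 then 1 else 0 := by
  have h1 := Finset.sum_range_succ'
    (fun l => (-1 : ℝ) ^ l * ((l + m - 1).choose m : ℝ) * (n.choose l : ℝ)) n
  rcases m with _ | m
  · have := alternating_sum_choose_shift n 0 0 h
    simp only [Nat.choose_zero_right, Nat.cast_one, mul_one] at h1 this ⊢
    rw [this] at h1
    simp only [pow_succ, mul_neg, neg_mul, Finset.sum_neg_distrib, mul_one, pow_zero] at h1
    simp only [if_true]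
    linarith
  · have := alternating_sum_choose_shift n (m + 1) m h
    have e : ∀ l, l + (m + 1) - 1 = m + l := by intro l; omega
    have e' : ∀ l, m + (l + 1) = l + m + 1 := by intro l; omega
    simp only [e] at h1
    rw [this] at h1
    simp only [pow_succ, mul_neg, neg_mul, Finset.sum_neg_distrib, mul_one, e', add_zero] at h1
    rw [if_neg (Nat.succ_ne_zero m)]
    simp only [← add_assoc]
    rw [Nat.zero_add] at h1
    rw [Nat.choose_succ_self] at h1
    simp only [Nat.cast_zero, mul_zero, zero_mul, add_zero] at h1
    linarith

/-- Both sides are `((w + 1) ^ n - 1) / w`. -/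
theorem geom_sum_eq_sum_choose {R : Type*} [Ring R] (w : R) (n : ℕ) :
    ∑ i ∈ Finset.range n, (w + 1) ^ i = ∑ m ∈ Finset.range n, (n.choose (m + 1) : R) * w ^ m := by
  induction n with
  | zero => simp
  | succ n ih =>
    rw [Finset.sum_range_succ, ih, (Commute.one_right w).add_pow]
    simp only [Nat.choose_succ_succ, Nat.cast_add, add_mul, Finset.sum_add_distrib, one_pow, mul_one]
    rw [Finset.sum_range_succ (fun m => ((n.choose (m + 1) : ℕ) : R) * w ^ m)]
    simp [add_comm, Nat.cast_comm]

/-! ### The Lyapunov equation of a nilpotent matrix -/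

section Lyapunov

variable {ι : Type*} [Fintype ι] [DecidableEq ι]

/-- The solution `∑_{l,m} (-1)^{l+m} C(l+m,m) (Aᵀ)^m e eᵀ A^l` of the Lyapunov equation
`F + Aᵀ F + F A = e eᵀ` for a matrix with `A ^ n = 0`. -/
noncomputable def lyap (A : Matrix ι ι ℝ) (e : ι → ℝ) (n : ℕ) : Matrix ι ι ℝ :=
  ∑ l ∈ Finset.range n, ∑ m ∈ Finset.range n,
    ((-1 : ℝ) ^ (l + m) * ((l + m).choose m : ℝ)) • vecMulVec (e ᵥ* A ^ m) (e ᵥ* A ^ l)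

theorem sum_mul_succ_eq (n : ℕ) (f x : ℕ → ℝ) (hx : x n = 0) :
    ∑ l ∈ Finset.range n, f l * x (l + 1) =
      ∑ l ∈ Finset.range n, (if l = 0 then 0 else f (l - 1)) * x l := by
  have := Finset.sum_range_succ' (fun l => (if l = 0 then 0 else f (l - 1)) * x l) n
  rw [Finset.sum_range_succ, hx] at this
  simpa using this.symm

/-- Pascal's rule for the coefficients `(-1)^{l+m} C(l+m,m)`, in summed form. -/
theorem sum_choose_shift (n : ℕ) (x y : ℕ → ℝ) (hx : x n = 0) (hy : y n = 0) (hn : 0 < n) :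
    (∑ l ∈ Finset.range n, ∑ m ∈ Finset.range n,
      ((-1 : ℝ) ^ (l + m) * ((l + m).choose m : ℝ)) * (y m * x l)) +
    (∑ l ∈ Finset.range n, ∑ m ∈ Finset.range n,
      ((-1 : ℝ) ^ (l + m) * ((l + m).choose m : ℝ)) * (y (m + 1) * x l)) +
    (∑ l ∈ Finset.range n, ∑ m ∈ Finset.range n,
      ((-1 : ℝ) ^ (l + m) * ((l + m).choose m : ℝ)) * (y m * x (l + 1))) = y 0 * x 0 := by
  have h1 : ∀ l, ∑ m ∈ Finset.range n,
      ((-1 : ℝ) ^ (l + m) * ((l + m).choose m : ℝ)) * (y (m + 1) * x l) =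
      ∑ m ∈ Finset.range n, (if m = 0 then 0 else
        ((-1 : ℝ) ^ (l + (m - 1)) * ((l + (m - 1)).choose (m - 1) : ℝ))) * (y m * x l) := by
    intro l
    have := sum_mul_succ_eq n (fun m => (-1 : ℝ) ^ (l + m) * ((l + m).choose m : ℝ)) y hy
    simp only [← mul_assoc, ← Finset.sum_mul]
    rw [this]
  have h2 : ∑ l ∈ Finset.range n, ∑ m ∈ Finset.range n,
      ((-1 : ℝ) ^ (l + m) * ((l + m).choose m : ℝ)) * (y m * x (l + 1)) =
      ∑ l ∈ Finset.range n, ∑ m ∈ Finset.range n, (if l = 0 then 0 else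
        ((-1 : ℝ) ^ ((l - 1) + m) * (((l - 1) + m).choose m : ℝ))) * (y m * x l) := by
    rw [Finset.sum_comm, Finset.sum_comm (s := Finset.range n) (t := Finset.range n)
      (f := fun l m => (if l = 0 then 0 else
        ((-1 : ℝ) ^ ((l - 1) + m) * (((l - 1) + m).choose m : ℝ))) * (y m * x l))]
    refine Finset.sum_congr rfl fun m _ => ?_
    have := sum_mul_succ_eq n (fun l => (-1 : ℝ) ^ (l + m) * ((l + m).choose m : ℝ)) x hx
    simp only [mul_comm (y m), ← mul_assoc, ← Finset.sum_mul]
    rw [this]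
  simp only [h1]
  rw [h2]
  simp only [← Finset.sum_add_distrib, ← add_mul]
  rw [Finset.sum_eq_single 0, Finset.sum_eq_single 0]
  · simp
  · intro m _ hm
    obtain ⟨m, rfl⟩ := Nat.exists_eq_succ_of_ne_zero hm
    simp [pow_succ]
  · simp [hn.ne']
  · intro l _ hl
    obtain ⟨l, rfl⟩ := Nat.exists_eq_succ_of_ne_zero hl
    refine Finset.sum_eq_zero fun m _ => ?_
    rcases Nat.eq_zero_or_pos m with rfl | hm
    · simp [pow_succ]
    · obtain ⟨m, rfl⟩ := Nat.exists_eq_succ_of_ne_zero hm.ne'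
      have e1 : l.succ + m.succ = (l + m + 1) + 1 := by omega
      have e2 : l.succ + (m.succ - 1) = l + m + 1 := by omega
      have e3 : l.succ - 1 + m.succ = l + m + 1 := by omega
      rw [e1, e2, e3, Nat.choose_succ_succ]
      simp only [Nat.succ_ne_zero, if_false, Nat.succ_sub_one, Nat.cast_add, Nat.succ_eq_add_one]
      ring
  · simp [hn.ne']

theorem lyap_equation (A : Matrix ι ι ℝ) (e : ι → ℝ) (n : ℕ) (hn : 0 < n) (hA : A ^ n = 0) :
    lyap A e n + Aᵀ * lyap A e n + lyap A e n * A = vecMulVec e e := by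
  have hr : ∀ m, (e ᵥ* A ^ m) ᵥ* A = e ᵥ* A ^ (m + 1) := by
    intro m; rw [vecMul_vecMul, pow_succ]
  have h0 : e ᵥ* A ^ n = 0 := by rw [hA, vecMul_zero]
  ext i j
  have := sum_choose_shift n (fun l => (e ᵥ* A ^ l) j) (fun m => (e ᵥ* A ^ m) i)
    (by simp [h0]) (by simp [h0]) hn
  simp only [pow_zero, vecMul_one] at this
  simp only [lyap, Finset.mul_sum, Finset.sum_mul, Matrix.mul_smul, Matrix.smul_mul,
    mul_vecMulVec, vecMulVec_mul, mulVec_transpose, hr, Matrix.add_apply, Matrix.sum_apply,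
    Matrix.smul_apply, vecMulVec_apply, smul_eq_mul]
  exact this

theorem lyap_transpose (A : Matrix ι ι ℝ) (e : ι → ℝ) (n : ℕ) :
    (lyap A e n)ᵀ = lyap A e n := by
  unfold lyap
  simp only [transpose_sum, transpose_smul, transpose_vecMulVec]
  rw [Finset.sum_comm]
  refine Finset.sum_congr rfl fun l _ => Finset.sum_congr rfl fun m _ => ?_
  rw [Nat.add_comm m l, Nat.choose_symm_add]

/-- The map `G ↦ Aᵀ G + G A` is nilpotent, being the sum of two commuting nilpotent maps. -/
theorem lyapunov_unique (A : Matrix ι ι ℝ) (hA : IsNilpotent A) {F G E : Matrix ι ι ℝ}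
    (hF : F + Aᵀ * F + F * A = E) (hG : G + Aᵀ * G + G * A = E) : F = G := by
  let φ : Module.End ℝ (Matrix ι ι ℝ) := LinearMap.mulLeft ℝ Aᵀ + LinearMap.mulRight ℝ A
  have hφ : IsNilpotent φ := by
    refine Commute.isNilpotent_add (LinearMap.commute_mulLeft_right ..) ?_ ?_
    · rw [LinearMap.isNilpotent_mulLeft_iff]
      obtain ⟨k, hk⟩ := hA
      exact ⟨k, by rw [← transpose_pow, hk, transpose_zero]⟩
    · rwa [LinearMap.isNilpotent_mulRight_iff]
  have hu : IsUnit (1 + φ) := hφ.isUnit_one_add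
  have hinj : Function.Injective ⇑(1 + φ : Module.End ℝ (Matrix ι ι ℝ)) := ((Module.End.isUnit_iff _).1 hu).1
  apply hinj
  have e : ∀ G : Matrix ι ι ℝ, (1 + φ : Module.End ℝ (Matrix ι ι ℝ)) G = G + Aᵀ * G + G * A := by
    intro G; simp [φ, add_assoc]
  rw [e, e, hF, hG]

theorem lyap_mulVec_one (A : Matrix ι ι ℝ) (e : ι → ℝ) (n : ℕ) (hn : 0 < n)
    (hP : ∀ m < n, (e ᵥ* A ^ m) ⬝ᵥ 1 = (n.choose (m + 1) : ℝ) / n) :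
    lyap A e n *ᵥ 1 = (1 / n : ℝ) • e := by
  have key : ∀ i, (lyap A e n *ᵥ 1) i = ∑ m ∈ Finset.range n, (-1 : ℝ) ^ m * (e ᵥ* A ^ m) i / n *
      ∑ l ∈ Finset.range n, (-1 : ℝ) ^ l * ((l + m).choose m : ℝ) * (n.choose (l + 1) : ℝ) := by
    intro i
    unfold lyap
    simp only [sum_mulVec, smul_mulVec, Finset.sum_apply, Pi.smul_apply, smul_eq_mul]
    rw [Finset.sum_comm]
    refine Finset.sum_congr rfl fun m _ => ?_
    rw [Finset.mul_sum]
    refine Finset.sum_congr rfl fun l hl => ?_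
    have : (vecMulVec (e ᵥ* A ^ m) (e ᵥ* A ^ l) *ᵥ 1) i =
        (e ᵥ* A ^ m) i * ((n.choose (l + 1) : ℝ) / n) := by
      rw [← hP l (Finset.mem_range.1 hl)]
      simp [mulVec, dotProduct, vecMulVec_apply, Finset.mul_sum]
    rw [this, pow_add]
    ring
  ext i
  rw [key, Finset.sum_eq_single 0]
  · rw [alternating_sum_choose_mul_choose n 0 hn]
    simp
    ring
  · intro m hm h0
    rw [alternating_sum_choose_mul_choose n m (Finset.mem_range.1 hm), if_neg h0, mul_zero]
  · simp [hn.ne']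

end Lyapunov

/-! ### Observability of a lower triangular nilpotent matrix from its last coordinate -/

/-- The indicator vector of the last index of `Fin N`. -/
def lastVec (N : ℕ) : Fin N → ℝ := fun i => if (i : ℕ) + 1 = N then 1 else 0

section Observability

variable {N : ℕ} {A : Matrix (Fin N) (Fin N) ℝ}

theorem lastVec_vecMul_pow_eq_zero (hA : ∀ i j, i ≤ j → A i j = 0) (m : ℕ) (i : Fin N)
    (h : N ≤ i + m) : (lastVec N ᵥ* A ^ m) i = 0 := by
  induction m generalizing i with
  | zero => exact absurd i.2 (by omega)
  | succ m ih =>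
    rw [pow_succ, ← vecMul_vecMul]
    show ∑ k, (lastVec N ᵥ* A ^ m) k * A k i = 0
    refine Finset.sum_eq_zero fun k _ => ?_
    by_cases hk : k ≤ i
    · simp [hA k i hk]
    · rw [ih k (by rw [not_le, Fin.lt_def] at hk; omega), zero_mul]

theorem pow_eq_zero_of_strictLower (hA : ∀ i j, i ≤ j → A i j = 0) : A ^ N = 0 := by
  have : ∀ m, ∀ i j : Fin N, (i : ℕ) < j + m → (A ^ m) i j = 0 := by
    intro m
    induction m with
    | zero =>
      intro i j h
      rw [pow_zero, one_apply_ne]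
      rintro rfl
      omega
    | succ m ih =>
      intro i j h
      rw [pow_succ, mul_apply]
      refine Finset.sum_eq_zero fun k _ => ?_
      by_cases hk : k ≤ j
      · simp [hA k j hk]
      · rw [ih i k (by rw [not_le, Fin.lt_def] at hk; omega), zero_mul]
  ext i j
  exact this N i j (by omega)

theorem lastVec_vecMul_pow_succ (hA : ∀ i j, i ≤ j → A i j = 0) (m : ℕ) (i k : Fin N)
    (h : (i : ℕ) + m + 2 = N) (hk : (k : ℕ) = i + 1) :
    (lastVec N ᵥ* A ^ (m + 1)) i = (lastVec N ᵥ* A ^ m) k * A k i := by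
  rw [pow_succ, ← vecMul_vecMul]
  refine Finset.sum_eq_single (M := ℝ) k (fun l _ hl => ?_) (fun h => absurd (Finset.mem_univ k) h)
  by_cases hli : l ≤ i
  · simp [hA l i hli]
  · rw [lastVec_vecMul_pow_eq_zero hA m l, zero_mul]
    rw [not_le, Fin.lt_def] at hli
    have : (l : ℕ) ≠ k := fun h => hl (Fin.ext h)
    omega

/-- If the last power of `A` seen from the last coordinate does not vanish, then neither does any
of the extreme entries of the vectors `eᵀ A ^ m`. -/
theorem lastVec_vecMul_pow_ne_zero (hA : ∀ i j, i ≤ j → A i j = 0)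
    (h1 : (lastVec N ᵥ* A ^ (N - 1)) ⬝ᵥ 1 ≠ 0) (m : ℕ) (i : Fin N) (h : (i : ℕ) + m + 1 = N) :
    (lastVec N ᵥ* A ^ m) i ≠ 0 := by
  obtain ⟨d, hd⟩ : ∃ d, d = (i : ℕ) := ⟨_, rfl⟩
  induction d generalizing i m with
  | zero =>
    intro h0
    apply h1
    refine Finset.sum_eq_zero fun k _ => ?_
    rcases Nat.eq_zero_or_pos k with hk | hk
    · have : k = i := Fin.ext (by omega)
      have e : N - 1 = m := by omega
      rw [this, e, h0, zero_mul]
    · rw [lastVec_vecMul_pow_eq_zero hA _ k (by omega), zero_mul]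
  | succ d ih =>
    have := ih (m + 1) ⟨d, by omega⟩ (by show d + (m + 1) + 1 = N; omega) rfl
    rw [lastVec_vecMul_pow_succ hA m ⟨d, by omega⟩ i (by show d + m + 2 = N; omega) hd.symm] at this
    exact left_ne_zero_of_mul this

theorem subdiagonal_ne_zero (hA : ∀ i j, i ≤ j → A i j = 0)
    (h1 : (lastVec N ᵥ* A ^ (N - 1)) ⬝ᵥ 1 ≠ 0) (i k : Fin N) (hk : (k : ℕ) = i + 1) :
    A k i ≠ 0 := by
  have := lastVec_vecMul_pow_ne_zero hA h1 (N - 1 - i) i (by omega)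
  have e : N - 1 - (i : ℕ) = (N - 2 - i) + 1 := by omega
  rw [e, lastVec_vecMul_pow_succ hA _ i k (by omega) hk] at this
  exact right_ne_zero_of_mul this

/-- Observability: the vectors `eᵀ A ^ m`, `m < N`, separate points. -/
theorem eq_zero_of_observed_eq_zero (hA : ∀ i j, i ≤ j → A i j = 0)
    (h1 : (lastVec N ᵥ* A ^ (N - 1)) ⬝ᵥ 1 ≠ 0) (v : Fin N → ℝ)
    (hv : ∀ m < N, (lastVec N ᵥ* A ^ m) ⬝ᵥ v = 0) : v = 0 := by
  have : ∀ d : ℕ, ∀ i : Fin N, (i : ℕ) = d → v i = 0 := by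
    intro d
    induction d using Nat.strong_induction_on with
    | _ d ih =>
      intro i hi
      have h2 := hv (N - 1 - i) (by omega)
      rw [dotProduct, Finset.sum_eq_single i] at h2
      · exact (mul_eq_zero.1 h2).resolve_left
          (lastVec_vecMul_pow_ne_zero hA h1 _ i (by omega))
      · intro k _ hk
        rcases lt_or_gt_of_ne hk with hk | hk
        · rw [ih k (by rw [Fin.lt_def] at hk; omega) k rfl, mul_zero]
        · rw [lastVec_vecMul_pow_eq_zero hA _ k (by rw [Fin.lt_def] at hk; omega),
            zero_mul]
      · simp
  ext i
  exact this i i rfl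

end Observability

/-! ### The Q-functions and the H-certificates in terms of the transfer matrix -/

/-- The matrix `A` with `y_k = y_0 - ∑_j A_{k,j} g_j` for the residuals `g_j = y_j - T y_j`
of the algorithm; it is the matrix of column partial sums of `H`, strictly lower triangular. -/
noncomputable def transfer (N : ℕ) (H : HMatrix N) : Matrix (Fin N) (Fin N) ℝ :=
  Matrix.of fun k j => ∑ i ∈ Finset.Icc ((j : ℕ) + 1) k, ent N H i (j + 1)

theorem transfer_apply (N : ℕ) (H : HMatrix N) (k j : Fin N) :
    transfer N H k j = ∑ i ∈ Finset.Icc ((j : ℕ) + 1) k, ent N H i (j + 1) := rfl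

theorem transfer_eq_zero (N : ℕ) (H : HMatrix N) (k j : Fin N) (h : k ≤ j) :
    transfer N H k j = 0 := by
  rw [transfer_apply, Finset.Icc_eq_empty, Finset.sum_empty]
  rw [Fin.le_def] at h
  omega

theorem transfer_pow_eq_zero (N : ℕ) (H : HMatrix N) : transfer N H ^ N = 0 :=
  pow_eq_zero_of_strictLower (transfer_eq_zero N H)

/-- Splitting off the first pair `(i(1), j(1)) = (i, j)` from the chains of indices in `qFun`. -/
theorem qFun_succ_aux (N : ℕ) (H : HMatrix N) (m j : ℕ) (hj : 1 ≤ j) :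
    qFun N H (m + 1) j = ∑ i ∈ Finset.Icc j (N - 1), ent N H i j *
      ∑ p ∈ (Fintype.piFinset (fun _ : Fin m => Finset.Icc 1 (N - 1)) ×ˢ
        Fintype.piFinset (fun _ : Fin m => Finset.Icc 1 (N - 1))) with
        ((∀ r : Fin m, (r : ℕ) = 0 → i < p.1 r) ∧
          (∀ r : Fin m, p.1 r ≤ p.2 r) ∧
          (∀ r s : Fin m, (s : ℕ) = (r : ℕ) + 1 → p.2 r < p.1 s)),
        ∏ r : Fin m, ent N H (p.2 r) (p.1 r) := by
  unfold qFun
  simp only [Finset.mul_sum]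
  rw [Finset.sum_sigma']
  refine Finset.sum_bij' (fun p _ => ⟨p.2 0, (Fin.tail p.1, Fin.tail p.2)⟩)
    (fun q _ => (Fin.cons j q.2.1, Fin.cons q.1 q.2.2)) ?_ ?_ ?_ ?_ ?_
  · rintro ⟨a, b⟩ h
    simp only [Finset.mem_filter, Finset.mem_product, Fintype.mem_piFinset, Finset.mem_Icc,
      Finset.mem_sigma, Fin.tail] at h ⊢
    obtain ⟨⟨h1, h2⟩, h3, h4, h5⟩ := h
    refine ⟨⟨h3 0 rfl ▸ h4 0, (h2 0).2⟩, ⟨fun r => h1 _, fun r => h2 _⟩, ?_, fun r => h4 _, ?_⟩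
    · intro r hr
      exact h5 0 r.succ (by simp [hr])
    · intro r s hrs
      exact h5 r.succ s.succ (by simp [hrs])
  · rintro ⟨i, a, b⟩ h
    simp only [Finset.mem_filter, Finset.mem_product, Fintype.mem_piFinset, Finset.mem_Icc,
      Finset.mem_sigma] at h ⊢
    obtain ⟨⟨h1, h2⟩, ⟨h3, h4⟩, h5, h6, h7⟩ := h
    refine ⟨⟨?_, ?_⟩, ?_, ?_, ?_⟩
    · intro r
      refine Fin.cases ?_ (fun r => ?_) r
      · simp only [Fin.cons_zero]; omega
      · simpa using h3 r
    · intro r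
      refine Fin.cases ?_ (fun r => ?_) r
      · simp only [Fin.cons_zero]; omega
      · simpa using h4 r
    · intro r
      refine Fin.cases ?_ (fun r => ?_) r
      · simp
      · simp
    · intro r
      refine Fin.cases ?_ (fun r => ?_) r
      · simpa using h1
      · simpa using h6 r
    · intro r s
      refine Fin.cases ?_ (fun s => ?_) s
      · simp
      · refine Fin.cases ?_ (fun r => ?_) r
        · intro hs
          simpa using h5 s (by simpa using hs)
        · intro hs
          simpa using h7 r s (by simpa using hs)
  · rintro ⟨a, b⟩ h
    simp only [Finset.mem_filter] at h
    rw [Prod.mk.injEq]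
    refine ⟨?_, Fin.cons_self_tail b⟩
    rw [← h.2.1 0 rfl]
    exact Fin.cons_self_tail a
  · rintro ⟨i, a, b⟩ h
    simp
  · rintro ⟨a, b⟩ h
    simp only [Finset.mem_filter] at h
    rw [Fin.prod_univ_succ, ← h.2.1 0 rfl]
    rfl

theorem qFun_one (N : ℕ) (H : HMatrix N) (j : ℕ) (hj : 1 ≤ j) :
    qFun N H 1 j = ∑ i ∈ Finset.Icc j (N - 1), ent N H i j := by
  rw [qFun_succ_aux N H 0 j hj]
  simp

theorem qFun_succ (N : ℕ) (H : HMatrix N) (m j : ℕ) (hm : 1 ≤ m) (hj : 1 ≤ j) :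
    qFun N H (m + 1) j = ∑ i ∈ Finset.Icc j (N - 1), ent N H i j *
      ∑ k ∈ Finset.Ico i N, qFun N H m (k + 1) := by
  rw [qFun_succ_aux N H m j hj]
  refine Finset.sum_congr rfl fun i hi => ?_
  congr 1
  obtain ⟨m, rfl⟩ := Nat.exists_eq_add_of_le' hm
  symm
  rw [← Finset.sum_fiberwise_of_maps_to (t := Finset.Ico i N) 
    (g := fun p : (Fin (m + 1) → ℕ) × (Fin (m + 1) → ℕ) => p.1 0 - 1)]
  · refine Finset.sum_congr rfl fun k hk => ?_
    unfold qFun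
    rw [Finset.filter_filter]
    refine Finset.sum_congr (Finset.filter_congr ?_) fun _ _ => rfl
    rintro ⟨a, b⟩ h
    simp only [Finset.mem_product, Fintype.mem_piFinset, Finset.mem_Icc] at h hk
    have h0 : 1 ≤ a 0 := (h.1 0).1
    rw [Finset.mem_Ico] at hk
    have e : ∀ r : Fin (m + 1), (r : ℕ) = 0 ↔ r = 0 := fun r => by
      rw [Fin.ext_iff]; rfl
    simp only [e, forall_eq]
    constructor
    · rintro ⟨h1, h2, h3⟩
      exact ⟨⟨by omega, h2, h3⟩, by omega⟩
    · rintro ⟨⟨h1, h2, h3⟩, h4⟩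
      exact ⟨by omega, h2, h3⟩
  · rintro ⟨a, b⟩ h
    simp only [Finset.mem_filter, Finset.mem_product, Fintype.mem_piFinset, Finset.mem_Icc] at h
    have h0 : 1 ≤ a 0 ∧ a 0 ≤ N - 1 := h.1.1 0
    have h1 : i < a 0 := h.2.1 0 rfl
    rw [Finset.mem_Ico]
    show i ≤ a 0 - 1 ∧ a 0 - 1 < N
    omega

theorem lastVec_dotProduct {N : ℕ} (k : Fin N) (hk : (k : ℕ) + 1 = N) (v : Fin N → ℝ) :
    lastVec N ⬝ᵥ v = v k := by
  rw [dotProduct, Finset.sum_eq_single k]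
  · simp [lastVec, hk]
  · intro i _ hi
    have : (i : ℕ) + 1 ≠ N := fun h => hi (Fin.ext (by omega))
    simp [lastVec, this]
  · simp

/-- The Q-functions are the entries of the last row of the powers of the transfer matrix. -/
theorem qFun_eq_vecMul_transfer_pow (N : ℕ) (H : HMatrix N) (m : ℕ) (hm : 1 ≤ m) (j : Fin N) :
    qFun N H m (j + 1) = (lastVec N ᵥ* transfer N H ^ m) j := by
  induction m, hm using Nat.le_induction generalizing j with
  | base =>
    have hj := j.2
    rw [qFun_one N H _ (by omega), pow_one]
    exact (lastVec_dotProduct (⟨N - 1, by omega⟩ : Fin N) (by show N - 1 + 1 = N; omega)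
      (fun k => transfer N H k j)).symm
  | succ m hm ih =>
    rw [qFun_succ N H m _ hm (by omega), pow_succ, ← vecMul_vecMul]
    have e : ((lastVec N ᵥ* transfer N H ^ m) ᵥ* transfer N H) j =
        ∑ k : Fin N, (fun k : ℕ => qFun N H m (k + 1) *
          ∑ i ∈ Finset.Icc ((j : ℕ) + 1) k, ent N H i (j + 1)) k := by
      show ∑ k, (lastVec N ᵥ* transfer N H ^ m) k * transfer N H k j = _
      refine Finset.sum_congr rfl fun k _ => ?_
      rw [← ih k, transfer_apply]
    rw [e, Fin.sum_univ_eq_sum_range (fun k : ℕ => qFun N H m (k + 1) *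
      ∑ i ∈ Finset.Icc ((j : ℕ) + 1) k, ent N H i (j + 1)) N]
    simp only [Finset.mul_sum]
    rw [Finset.sum_comm' (t' := Finset.range N) (s' := fun k => Finset.Icc ((j : ℕ) + 1) k)]
    · exact Finset.sum_congr rfl fun _ _ => Finset.sum_congr rfl fun _ _ => mul_comm _ _
    · intro x y
      simp only [Finset.mem_Icc, Finset.mem_Ico, Finset.mem_range]
      omega

theorem sum_range_eq_add_sum_Icc (N : ℕ) (hN : 0 < N) (f : ℕ → ℝ) :
    ∑ i ∈ Finset.range N, f i = f 0 + ∑ i ∈ Finset.Icc 1 (N - 1), f i := by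
  have : Finset.range N = insert 0 (Finset.Icc 1 (N - 1)) := by
    ext i
    simp only [Finset.mem_range, Finset.mem_insert, Finset.mem_Icc]
    omega
  rw [this, Finset.sum_insert (by simp)]

/-- The H-certificates are, up to the factor `-N`, the entries below the diagonal of the solution
of the Lyapunov equation of the transfer matrix. -/
theorem cert_eq_lyap (N : ℕ) (H : HMatrix N) (k j : Fin N) (hjk : j < k) :
    cert N H (k + 1) (j + 1) = -(N : ℝ) * lyap (transfer N H) (lastVec N) N k j := by
  have hN : 0 < N := by have := k.2; omega
  rw [Fin.lt_def] at hjk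
  have hj0 : lastVec N j = 0 := by
    have := k.2
    exact if_neg (by omega)
  -- the terms `l = 0` vanish since `j` is not the last node
  have hl : lyap (transfer N H) (lastVec N) N k j =
      ∑ l ∈ Finset.Icc 1 (N - 1), ∑ m ∈ Finset.range N,
        (-1 : ℝ) ^ (l + m) * ((l + m).choose m : ℝ) *
          ((lastVec N ᵥ* transfer N H ^ m) k * (lastVec N ᵥ* transfer N H ^ l) j) := by
    simp only [lyap, Matrix.sum_apply, Matrix.smul_apply, vecMulVec_apply, smul_eq_mul]
    rw [sum_range_eq_add_sum_Icc N hN]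
    simp [hj0]
  rw [hl]
  have q := qFun_eq_vecMul_transfer_pow N H
  unfold cert
  split_ifs with hk
  · -- at the last node only the term `m = 0` survives
    have hz : ∀ m, 1 ≤ m → (lastVec N ᵥ* transfer N H ^ m) k = 0 := fun m hm =>
      lastVec_vecMul_pow_eq_zero (transfer_eq_zero N H) m k (by omega)
    have hk1 : lastVec N k = 1 := if_pos hk
    rw [neg_mul, ← mul_neg, ← Finset.sum_neg_distrib]
    congr 1
    refine Finset.sum_congr rfl fun l hl => ?_
    rw [Finset.mem_Icc] at hl
    rw [sum_range_eq_add_sum_Icc N hN, Finset.sum_eq_zero (s := Finset.Icc 1 (N - 1)), q l hl.1 j]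
    · obtain ⟨l, rfl⟩ := Nat.exists_eq_add_of_le' hl.1
      simp [hk1, pow_succ]
    · intro m hm
      rw [hz m (Finset.mem_Icc.1 hm).1]
      ring
  · have hk0 : lastVec N k = 0 := if_neg hk
    rw [neg_mul, ← mul_neg, ← Finset.sum_neg_distrib]
    congr 1
    refine Finset.sum_congr rfl fun l hl => ?_
    rw [Finset.mem_Icc] at hl
    rw [sum_range_eq_add_sum_Icc N hN, pow_zero, vecMul_one, hk0, zero_mul, mul_zero, zero_add,
      ← Finset.sum_neg_distrib]
    refine Finset.sum_congr rfl fun m hm => ?_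
    rw [Finset.mem_Icc] at hm
    rw [q l hl.1 j, q m hm.1 k]
    obtain ⟨l, rfl⟩ := Nat.exists_eq_add_of_le' hl.1
    have e : l + 1 + m - 1 = l + m := by omega
    have e' : l + 1 + m = l + m + 1 := by omega
    rw [e, e', pow_succ]
    ring

/-! ### The energy identity and sufficiency of the certificate -/

section Energy

variable {V : Type*} [NormedAddCommGroup V] [InnerProductSpace ℝ V]

theorem inner_residual_sub (a b a' b' : V) :
    inner ℝ ((a - a') - (b - b')) ((a - (1 / 2 : ℝ) • (a - a')) - (b - (1 / 2 : ℝ) • (b - b')))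
      = (‖a - b‖ ^ 2 - ‖a' - b'‖ ^ 2) / 2 := by
  have h1 : (a - a') - (b - b') = (a - b) - (a' - b') := by abel
  have h2 : (a - (1 / 2 : ℝ) • (a - a')) - (b - (1 / 2 : ℝ) • (b - b'))
      = (1 / 2 : ℝ) • ((a - b) + (a' - b')) := by module
  rw [h1, h2]
  generalize a - b = d
  generalize a' - b' = d'
  rw [inner_smul_right, inner_add_right, inner_sub_left, inner_sub_left,
    real_inner_self_eq_norm_sq, real_inner_self_eq_norm_sq, real_inner_comm d d']
  ring

theorem sum_lastVec_mul {N : ℕ} (k : Fin N) (hk : (k : ℕ) + 1 = N) (v : Fin N → ℝ) :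
    ∑ i, lastVec N i * v i = v k := lastVec_dotProduct k hk v

/-- The performance deficit of an algorithm with transfer matrix `A`, as a square plus a
combination of the monotonicity expressions `⟪g_k - g_l, X_k - X_l⟫` whose coefficients are the
entries of the solution of the Lyapunov equation. -/
theorem energy_identity {N : ℕ} (A F : Matrix (Fin N) (Fin N) ℝ)
    (hF : F + Aᵀ * F + F * A = vecMulVec (lastVec N) (lastVec N)) (hFt : Fᵀ = F)
    (h1 : F *ᵥ 1 = (1 / N : ℝ) • lastVec N) (g X : Fin N → V) (y0 : V)
    (hX : ∀ l, X l = y0 - ∑ j, A l j • g j - (1 / 2 : ℝ) • g l)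
    (n : Fin N) (hn : (n : ℕ) + 1 = N) :
    ‖y0‖ ^ 2 - (N : ℝ) ^ 2 / 4 * ‖g n‖ ^ 2 =
      ‖y0 - (N / 2 : ℝ) • g n‖ ^ 2 + N * inner ℝ (g n) (X n)
      - (N : ℝ) ^ 2 / 2 * ∑ k, ∑ l, F k l * inner ℝ (g k - g l) (X k - X l) := by
  have hN : (N : ℝ) ≠ 0 := by
    have : N ≠ 0 := by omega
    exact_mod_cast this
  have hsym : ∀ k l, F l k = F k l := fun k l => congrFun (congrFun hFt k) l
  have hrow : ∀ k, ∑ l, F k l = 1 / N * lastVec N k := fun k => by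
    have := congrFun h1 k
    simpa [mulVec, dotProduct] using this
  -- summation against the row sums of `F`
  have hdiag : ∀ v : Fin N → ℝ, ∑ k, ∑ l, F k l * v k = 1 / N * v n := by
    intro v
    simp only [← Finset.sum_mul, hrow, mul_assoc]
    rw [← Finset.mul_sum, sum_lastVec_mul n hn]
  have hFA : ∑ k, ∑ l, (F * A) k l * inner ℝ (g k) (g l) =
      (‖g n‖ ^ 2 - ∑ k, ∑ l, F k l * inner ℝ (g k) (g l)) / 2 := by
    have e1 : ∑ k, ∑ l, (Aᵀ * F) k l * inner ℝ (g k) (g l) =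
        ∑ k, ∑ l, (F * A) k l * inner ℝ (g k) (g l) := by
      have : Aᵀ * F = (F * A)ᵀ := by rw [transpose_mul, hFt]
      rw [this, Finset.sum_comm]
      exact Finset.sum_congr rfl fun k _ => Finset.sum_congr rfl fun l _ => by
        rw [transpose_apply, real_inner_comm]
    have e2 : ∑ k, ∑ l, vecMulVec (lastVec N) (lastVec N) k l * inner ℝ (g k) (g l) =
        ‖g n‖ ^ 2 := by
      simp only [vecMulVec_apply, mul_assoc, ← Finset.mul_sum]
      simp only [sum_lastVec_mul n hn]
      rw [real_inner_self_eq_norm_sq]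
    rw [← hF] at e2
    simp only [Matrix.add_apply, add_mul, Finset.sum_add_distrib] at e2
    rw [e1] at e2
    linarith
  have hcross : ∑ k, ∑ l, F k l * inner ℝ (g k) (X l) =
      1 / N * inner ℝ (g n) y0 - ‖g n‖ ^ 2 / 2 := by
    have e : ∀ k l, F k l * inner ℝ (g k) (X l) = F k l * inner ℝ (g k) y0
        - ∑ j, F k l * A l j * inner ℝ (g k) (g j) - 1 / 2 * (F k l * inner ℝ (g k) (g l)) := by
      intro k l
      rw [hX, inner_sub_right, inner_sub_right, inner_sum, mul_sub, mul_sub, Finset.mul_sum,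
        inner_smul_right]
      congr 1
      · congr 1
        exact Finset.sum_congr rfl fun j _ => by rw [inner_smul_right, mul_assoc]
      · ring
    simp only [e, Finset.sum_sub_distrib]
    have e3 : ∑ k, ∑ l, ∑ j, F k l * A l j * inner ℝ (g k) (g j) =
        ∑ k, ∑ l, (F * A) k l * inner ℝ (g k) (g l) := by
      refine Finset.sum_congr rfl fun k _ => ?_
      rw [Finset.sum_comm]
      simp only [mul_apply, Finset.sum_mul]
    rw [e3, hFA, hdiag (fun k => inner ℝ (g k) y0)]
    simp only [← Finset.mul_sum]
    ring
  have hpair : ∑ k, ∑ l, F k l * inner ℝ (g k - g l) (X k - X l) =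
      2 * (1 / N * inner ℝ (g n) (X n)) - 2 * ∑ k, ∑ l, F k l * inner ℝ (g k) (X l) := by
    have e : ∀ k l, F k l * inner ℝ (g k - g l) (X k - X l) = F k l * inner ℝ (g k) (X k)
        - F k l * inner ℝ (g k) (X l) - F l k * inner ℝ (g l) (X k)
        + F l k * inner ℝ (g l) (X l) := by
      intro k l
      rw [inner_sub_left, inner_sub_right, inner_sub_right, hsym k l]
      ring
    simp only [e, Finset.sum_sub_distrib, Finset.sum_add_distrib]
    rw [Finset.sum_comm (f := fun k l => F l k * inner ℝ (g l) (X k)),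
      Finset.sum_comm (f := fun k l => F l k * inner ℝ (g l) (X l)),
      hdiag (fun k => inner ℝ (g k) (X k))]
    ring
  rw [hpair, hcross, norm_sub_sq_real, norm_smul, inner_smul_right, real_inner_comm (g n) y0,
    mul_pow, Real.norm_eq_abs, sq_abs]
  field_simp
  ring

end Energy

theorem sum_ent_recursion {V : Type*} [AddCommGroup V] [Module ℝ V] (N : ℕ) (H : HMatrix N)
    (y G : ℕ → V)
    (hy : ∀ k, k < N - 1 →
      y (k + 1) = y k - ∑ j ∈ Finset.range (k + 1), ent N H (k + 1) (j + 1) • G j)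
    (k : Fin N) : y k = y 0 - ∑ j : Fin N, transfer N H k j • G j := by
  obtain ⟨k, hk⟩ := k
  simp only [transfer_apply]
  rw [Fin.sum_univ_eq_sum_range
    (fun j : ℕ => (∑ i ∈ Finset.Icc (j + 1) k, ent N H i (j + 1)) • G j) N]
  induction k with
  | zero => simp
  | succ k ih =>
    rw [hy k (by omega), ih (by omega), sub_sub]
    congr 1
    have hsub : Finset.range (k + 1) ⊆ Finset.range N := by
      rw [Finset.range_subset_range]; omega
    have e : ∑ j ∈ Finset.range (k + 1), ent N H (k + 1) (j + 1) • G j =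
        ∑ j ∈ Finset.range N, if j < k + 1 then ent N H (k + 1) (j + 1) • G j else 0 := by
      rw [← Finset.sum_filter]
      refine Finset.sum_congr ?_ fun _ _ => rfl
      ext j
      simp only [Finset.mem_range, Finset.mem_filter]
      omega
    rw [e, ← Finset.sum_add_distrib]
    refine Finset.sum_congr rfl fun j _ => ?_
    split_ifs with hjk
    · rw [Finset.sum_Icc_succ_top (by omega), add_smul]
    · rw [Finset.Icc_eq_empty (by omega), Finset.Icc_eq_empty (by omega)]
      simp

/-- The algebraic conditions characterizing the optimal step-size matrices: the row sums of the
Lyapunov solution vanish except for the last one, which is `1 / N`, and its entries below the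
diagonal (the negatives of the H-certificates, up to a factor) are nonpositive. -/
structure IsCertified (N : ℕ) (H : HMatrix N) : Prop where
  lower : _root_.IsLowerTriangular H
  rowSum : lyap (transfer N H) (lastVec N) N *ᵥ 1 = (1 / N : ℝ) • lastVec N
  nonpos : ∀ k j : Fin N, j < k → lyap (transfer N H) (lastVec N) N k j ≤ 0

theorem IsCertified.mem_optimal {N : ℕ} (hN : 1 ≤ N) {H : HMatrix N} (h : IsCertified N H) :
    H ∈ optimalHMatrices.{u} N := by
  refine ⟨h.lower, ?_⟩
  intro X _ _ _ T hT yStar hStar y hy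
  have hN' : (0 : ℝ) < N := by exact_mod_cast hN
  have hFt := lyap_transpose (transfer N H) (lastVec N) N
  have hFe := lyap_equation _ (lastVec N) N hN (transfer_pow_eq_zero N H)
  have hF1 := h.rowSum
  have hnp := h.nonpos
  have hrec := sum_ent_recursion N H y (fun j => y j - T (y j)) hy
  generalize lyap (transfer N H) (lastVec N) N = F at hFt hFe hF1 hnp
  generalize transfer N H = A at hFe hrec
  have hoff : ∀ k l : Fin N, k ≠ l → F k l ≤ 0 := by
    intro k l hkl
    rcases lt_or_gt_of_ne hkl with hlt | hlt
    · rw [← hFt]; exact hnp l k hlt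
    · exact hnp k l hlt
  let n : Fin N := ⟨N - 1, by omega⟩
  have key := energy_identity A F hFe hFt hF1
    (fun k => y k - T (y k)) (fun k => (y k - (1 / 2 : ℝ) • (y k - T (y k))) - yStar)
    (y 0 - yStar) (fun l => by
      show y l - (1 / 2 : ℝ) • (y l - T (y l)) - yStar =
        y 0 - yStar - ∑ j, A l j • (y j - T (y j)) - (1 / 2 : ℝ) • (y l - T (y l))
      rw [sub_right_comm]
      congr 1
      rw [sub_right_comm (y 0), ← hrec l]) n (by show N - 1 + 1 = N; omega)
  have hfix : 0 ≤ inner ℝ (y n - T (y n)) ((y n - (1 / 2 : ℝ) • (y n - T (y n))) - yStar) := by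
    have := inner_residual_sub (y n) yStar (T (y n)) (T yStar)
    rw [hStar] at this
    simp only [sub_self, smul_zero, sub_zero] at this
    rw [this]
    have h2 := hT (y n) yStar
    rw [hStar] at h2
    have := pow_le_pow_left₀ (norm_nonneg _) h2 2
    linarith
  have hsum : ∑ k : Fin N, ∑ l : Fin N, F k l * inner ℝ ((y k - T (y k)) - (y l - T (y l)))
      (((y k - (1 / 2 : ℝ) • (y k - T (y k))) - yStar)
        - ((y l - (1 / 2 : ℝ) • (y l - T (y l))) - yStar)) ≤ 0 := by
    refine Finset.sum_nonpos fun k _ => Finset.sum_nonpos fun l _ => ?_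
    rw [sub_sub_sub_cancel_right, inner_residual_sub]
    rcases eq_or_ne k l with rfl | hkl
    · simp
    · refine mul_nonpos_of_nonpos_of_nonneg (hoff k l hkl) ?_
      have := pow_le_pow_left₀ (norm_nonneg _) (hT (y k) (y l)) 2
      linarith
  have hgoal : 0 ≤ ‖y 0 - yStar‖ ^ 2 - (N : ℝ) ^ 2 / 4 * ‖y n - T (y n)‖ ^ 2 := by
    rw [key]
    have h1 := mul_nonneg hN'.le hfix
    have h2 := mul_nonneg (by positivity : (0 : ℝ) ≤ (N : ℝ) ^ 2 / 2) (neg_nonneg.2 hsum)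
    have h3 := sq_nonneg ‖y 0 - yStar - (N / 2 : ℝ) • (y n - T (y n))‖
    linarith
  rw [le_div_iff₀ (by positivity)]
  show ‖y (n : ℕ) - T (y (n : ℕ))‖ ^ 2 * (N : ℝ) ^ 2 ≤ _
  linarith

/-! ### The worst-case isometry and the invariants of optimal matrices -/

/-- The sequence with `v_{k+1} = v_k - ∑_{j ≤ k} c_{k,j} • G_j (v_j)`. -/
noncomputable def stepSeq {V : Type*} [AddCommGroup V] [Module ℝ V] (c : ℕ → ℕ → ℝ)
    (G : ℕ → V → V) (v0 : V) : ℕ → V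
  | 0 => v0
  | k + 1 => stepSeq c G v0 k - ∑ j : Fin (k + 1), c k j • G j (stepSeq c G v0 j)
  decreasing_by all_goals omega

theorem stepSeq_zero {V : Type*} [AddCommGroup V] [Module ℝ V] (c : ℕ → ℕ → ℝ)
    (G : ℕ → V → V) (v0 : V) : stepSeq c G v0 0 = v0 := by
  rw [stepSeq]

theorem stepSeq_succ {V : Type*} [AddCommGroup V] [Module ℝ V] (c : ℕ → ℕ → ℝ)
    (G : ℕ → V → V) (v0 : V) (k : ℕ) : stepSeq c G v0 (k + 1) = stepSeq c G v0 k -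
      ∑ j ∈ Finset.range (k + 1), c k j • G j (stepSeq c G v0 j) := by
  rw [stepSeq, Fin.sum_univ_eq_sum_range (fun j => c k j • G j (stepSeq c G v0 j))]

theorem exists_isTrajectory {X : Type u} [NormedAddCommGroup X] [InnerProductSpace ℝ X]
    (N : ℕ) (H : HMatrix N) (T : X → X) (y0 : X) : ∃ y : ℕ → X, y 0 = y0 ∧ IsTrajectory N H T y :=
  ⟨stepSeq (fun k j => ent N H (k + 1) (j + 1)) (fun _ v => v - T v) y0, stepSeq_zero _ _ _,
    fun k _ => stepSeq_succ _ _ _ k⟩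

section WorstCase

variable {N : ℕ} {X : Type u} [NormedAddCommGroup X] [InnerProductSpace ℝ X]

/-- `U` shifts the orthonormal basis `b` cyclically, with a change of sign at the end. -/
structure IsSignedShift (b : OrthonormalBasis (Fin N) ℝ X) (U : X →ₗᵢ[ℝ] X) : Prop where
  succ : ∀ i j : Fin N, (j : ℕ) = i + 1 → U (b i) = b j
  last : ∀ i j : Fin N, (i : ℕ) + 1 = N → (j : ℕ) = 0 → U (b i) = -b j

theorem exists_isSignedShift (b : OrthonormalBasis (Fin N) ℝ X) :
    ∃ U : X →ₗᵢ[ℝ] X, IsSignedShift b U := by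
  let c : Fin N → X := fun i => if h : (i : ℕ) + 1 < N then b ⟨i + 1, h⟩ else -b ⟨0, i.pos⟩
  have hb := orthonormal_iff_ite.1 b.orthonormal
  have hc : Orthonormal ℝ c := by
    rw [orthonormal_iff_ite]
    intro i j
    simp only [c]
    split_ifs with h1 h2 h3 h2 h3 <;>
      simp only [inner_neg_left, inner_neg_right, hb, Fin.mk.injEq, neg_neg, neg_eq_zero]
    all_goals simp [Fin.ext_iff] at *
    all_goals omega
  let f : X →ₗ[ℝ] X := b.toBasis.constr ℝ c
  have hf : ∀ i, f (b i) = c i := fun i => by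
    have := b.toBasis.constr_basis ℝ c i
    rwa [b.coe_toBasis] at this
  refine ⟨f.isometryOfOrthonormal (v := b.toBasis) (by rw [b.coe_toBasis]; exact b.orthonormal)
    (by
      have : f ∘ b.toBasis = c := by
        ext i; rw [Function.comp_apply, b.coe_toBasis, hf]
      rw [this]; exact hc), ⟨?_, ?_⟩⟩
  · intro i j hij
    show f (b i) = b j
    rw [hf]
    have hlt : (i : ℕ) + 1 < N := by have := j.2; omega
    simp only [c, hlt, dif_pos]
    congr 1
    exact Fin.ext hij.symm
  · intro i j hi hj
    show f (b i) = -b j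
    rw [hf]
    have hlt : ¬ (i : ℕ) + 1 < N := by omega
    simp only [c, hlt, dif_neg, not_false_eq_true]
    congr 2
    exact Fin.ext hj.symm

/-- The span of the basis vectors with index at most `k`. -/
def lowSpan (b : OrthonormalBasis (Fin N) ℝ X) (k : ℕ) : Submodule ℝ X :=
  Submodule.span ℝ (b '' {i | (i : ℕ) ≤ k})

theorem lowSpan_mono (b : OrthonormalBasis (Fin N) ℝ X) {k l : ℕ} (h : k ≤ l) :
    lowSpan b k ≤ lowSpan b l :=
  Submodule.span_mono (Set.image_mono fun _ hi => le_trans hi h)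

theorem mem_lowSpan (b : OrthonormalBasis (Fin N) ℝ X) (i : Fin N) (k : ℕ) (h : (i : ℕ) ≤ k) :
    b i ∈ lowSpan b k :=
  Submodule.subset_span ⟨i, h, rfl⟩

variable {b : OrthonormalBasis (Fin N) ℝ X} {U : X →ₗᵢ[ℝ] X}

theorem IsSignedShift.map_lowSpan (hU : IsSignedShift b U) {k : ℕ} (hk : k + 1 < N) {v : X} (hv : v ∈ lowSpan b k) :
    U v ∈ lowSpan b (k + 1) := by
  induction hv using Submodule.span_induction with
  | mem x h =>
    obtain ⟨i, hi, rfl⟩ := h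
    have hi' : (i : ℕ) ≤ k := hi
    rw [hU.succ i ⟨i + 1, by omega⟩ rfl]
    exact mem_lowSpan b _ _ (by show (i : ℕ) + 1 ≤ k + 1; omega)
  | zero => rw [map_zero]; exact zero_mem _
  | add x y _ _ hx hy => rw [map_add]; exact add_mem hx hy
  | smul a x _ hx => rw [map_smul]; exact Submodule.smul_mem _ _ hx

theorem inner_basis_sum (i : Fin N) : inner ℝ (b i) (∑ j, b j) = (1 : ℝ) := by
  rw [inner_sum]
  simp [orthonormal_iff_ite.1 b.orthonormal]

theorem IsSignedShift.map_sum_basis (hU : IsSignedShift b U) (z : Fin N) (hz : (z : ℕ) = 0) :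
    U (∑ j, b j) = ∑ j, b j - (2 : ℝ) • b z := by
  obtain ⟨n, rfl⟩ : ∃ n, N = n + 1 := ⟨N - 1, by have := z.2; omega⟩
  have hz' : z = 0 := Fin.ext hz
  have h1 : ∑ j : Fin (n + 1), U (b j) = ∑ j : Fin n, U (b j.castSucc) + U (b (Fin.last n)) :=
    Fin.sum_univ_castSucc _
  have h2 : ∑ j : Fin (n + 1), b j = b 0 + ∑ j : Fin n, b j.succ := Fin.sum_univ_succ _
  rw [map_sum, h1, h2, hU.last (Fin.last n) z rfl hz, hz']
  have : ∀ j : Fin n, U (b j.castSucc) = b j.succ := fun j => hU.succ _ _ (by simp)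
  simp only [this]
  module

theorem IsSignedShift.inner_map_sum (hU : IsSignedShift b U) {k : ℕ} (hk : k + 1 < N) {v : X}
    (hv : v ∈ lowSpan b k) : inner ℝ (v - U v) (∑ j, b j) = (0 : ℝ) := by
  induction hv using Submodule.span_induction with
  | mem x h =>
    obtain ⟨i, hi, rfl⟩ := h
    have hi' : (i : ℕ) ≤ k := hi
    rw [hU.succ i ⟨i + 1, by omega⟩ rfl, inner_sub_left, inner_basis_sum, inner_basis_sum, sub_self]
  | zero => simp
  | add x y _ _ hx hy =>
    rw [inner_sub_left, sub_eq_zero] at hx hy ⊢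
    rw [map_add, inner_add_left, inner_add_left, hx, hy]
  | smul a x _ hx =>
    rw [inner_sub_left, sub_eq_zero] at hx ⊢
    rw [map_smul, inner_smul_left, inner_smul_left, hx]

/-- The residuals along the worst-case isometry satisfy `g = (1 - U)(y_0 - A g)`. -/
theorem IsSignedShift.residual_eq (hU : IsSignedShift b U) {H : HMatrix N} {y : ℕ → X}
    (hy0 : y 0 = ∑ j, b j) (hy : IsTrajectory N H U y) (k z : Fin N) (hz : (z : ℕ) = 0) :
    y k - U (y k) = (2 : ℝ) • b z - (∑ j : Fin N, transfer N H k j • (y j - U (y j)) -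
      U (∑ j : Fin N, transfer N H k j • (y j - U (y j)))) := by
  have h := sum_ent_recursion N H y (fun j => y j - U (y j)) hy k
  beta_reduce at h
  generalize ∑ j : Fin N, transfer N H k j • (y j - U (y j)) = S at h ⊢
  rw [h, hy0, map_sub, hU.map_sum_basis z hz]
  module

theorem IsSignedShift.residual_mem (hU : IsSignedShift b U) {H : HMatrix N} {y : ℕ → X}
    (hy0 : y 0 = ∑ j, b j) (hy : IsTrajectory N H U y) (k : ℕ) (hk : k < N) :
    y k - U (y k) ∈ lowSpan b k ∧ inner ℝ (y k - U (y k)) (∑ j, b j) = (2 : ℝ) := by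
  induction k using Nat.strong_induction_on with
  | _ k ih =>
    have hN : 0 < N := by omega
    have hres := hU.residual_eq hy0 hy ⟨k, hk⟩ ⟨0, hN⟩ rfl
    simp only at hres
    have hb2 : inner ℝ ((2 : ℝ) • b ⟨0, hN⟩) (∑ j, b j) = (2 : ℝ) := by
      rw [inner_smul_left, inner_basis_sum]; simp
    rcases Nat.eq_zero_or_pos k with rfl | hk0
    · have hz : ∑ j : Fin N, transfer N H ⟨0, hk⟩ j • (y j - U (y j)) = 0 :=
        Finset.sum_eq_zero fun j _ => by
          rw [transfer_eq_zero N H _ j (by rw [Fin.le_def]; exact Nat.zero_le _), zero_smul]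
      rw [hz, map_zero, sub_zero, sub_zero] at hres
      rw [hres]
      exact ⟨Submodule.smul_mem _ _ (mem_lowSpan b _ _ le_rfl), hb2⟩
    · have hS : ∑ j : Fin N, transfer N H ⟨k, hk⟩ j • (y j - U (y j)) ∈ lowSpan b (k - 1) := by
        refine Submodule.sum_mem _ fun j _ => ?_
        by_cases hj : (j : ℕ) < k
        · exact Submodule.smul_mem _ _ (lowSpan_mono b (by omega) (ih j hj j.2).1)
        · rw [transfer_eq_zero N H _ j (by rw [Fin.le_def]; show k ≤ j; omega), zero_smul]
          exact zero_mem _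
      have h1 := hU.map_lowSpan (by omega) hS
      have h2 := hU.inner_map_sum (by omega) hS
      rw [Nat.sub_add_cancel hk0] at h1
      rw [hres]
      refine ⟨sub_mem (Submodule.smul_mem _ _ (mem_lowSpan b _ _ (Nat.zero_le k)))
        (sub_mem (lowSpan_mono b (by omega) hS) h1), ?_⟩
      rw [inner_sub_left, h2, hb2, sub_zero]

/-- On the worst case, the final residual of an optimal method is forced to be
`(2 / N) (y_0 - y⋆)`: its inner product with `y_0 - y⋆` does not depend on the method, and the
performance bound is then the equality case of the Cauchy-Schwarz inequality. -/
theorem IsSignedShift.last_residual_eq [CompleteSpace X] (hU : IsSignedShift b U) {H : HMatrix N}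
    (hH : H ∈ optimalHMatrices.{u} N) {y : ℕ → X}
    (hy0 : y 0 = ∑ j, b j) (hy : IsTrajectory N H U y) (hN : 0 < N) :
    y (N - 1) - U (y (N - 1)) = (2 / N : ℝ) • ∑ j, b j := by
  have hN' : (N : ℝ) ≠ 0 := by exact_mod_cast hN.ne'
  have hopt := hH.2 X U (fun x y => by rw [← map_sub, LinearIsometry.norm_map]) 0 (map_zero U) y hy
  have hnorm : ‖∑ j, b j‖ ^ 2 = (N : ℝ) := by
    rw [← real_inner_self_eq_norm_sq, sum_inner]
    simp [inner_basis_sum]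
  rw [sub_zero, hy0, hnorm] at hopt
  have h2 := (hU.residual_mem hy0 hy (N - 1) (by omega)).2
  rw [← sub_eq_zero, ← norm_eq_zero, ← sq_eq_zero_iff]
  refine le_antisymm ?_ (sq_nonneg _)
  rw [norm_sub_sq_real, inner_smul_right, h2, norm_smul, mul_pow, hnorm, Real.norm_eq_abs, sq_abs]
  have e : 4 * (N : ℝ) / (N : ℝ) ^ 2 = 4 / N := by field_simp
  rw [e] at hopt
  have e2 : (2 / (N : ℝ)) ^ 2 * N = 4 / N := by field_simp; norm_num
  rw [e2]
  have e3 : 2 * (2 / (N : ℝ) * 2) = 4 / N + 4 / N := by ring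
  rw [e3]
  linarith

/-- The final residual as a polynomial in `U - 1` applied to `2 b_0`. -/
theorem IsSignedShift.last_residual_expansion (hU : IsSignedShift b U) {H : HMatrix N} {y : ℕ → X}
    (hy0 : y 0 = ∑ j, b j) (hy : IsTrajectory N H U y) (z : Fin N) (hz : (z : ℕ) = 0) :
    y (N - 1) - U (y (N - 1)) = ∑ m ∈ Finset.range N,
      ((lastVec N ᵥ* transfer N H ^ m) ⬝ᵥ 1) •
        ((U.toLinearMap - 1 : Module.End ℝ X) ^ m) ((2 : ℝ) • b z) := by
  have hN : 0 < N := z.pos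
  set w : Module.End ℝ X := U.toLinearMap - 1 with hw
  have hwv : ∀ v, w v = U v - v := fun v => rfl
  have key : ∀ M, y (N - 1) - U (y (N - 1)) = ∑ m ∈ Finset.range M,
      ((lastVec N ᵥ* transfer N H ^ m) ⬝ᵥ 1) • (w ^ m) ((2 : ℝ) • b z) +
      (w ^ M) (∑ j, (lastVec N ᵥ* transfer N H ^ M) j • (y j - U (y j))) := by
    intro M
    induction M with
    | zero =>
      rw [Finset.sum_range_zero, zero_add, pow_zero, pow_zero, vecMul_one,
        Finset.sum_eq_single ⟨N - 1, by omega⟩]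
      · rw [lastVec, if_pos (by show N - 1 + 1 = N; omega), one_smul]; rfl
      · intro i _ hi
        rw [lastVec, if_neg, zero_smul]
        intro h
        exact hi (Fin.ext (by show (i : ℕ) = N - 1; omega))
      · intro h; exact absurd (Finset.mem_univ _) h
    | succ M ih =>
      rw [ih, Finset.sum_range_succ, add_assoc]
      congr 1
      rw [pow_succ w M, Module.End.mul_apply, ← map_smul, ← map_add]
      congr 1
      have e : ∀ j : Fin N, (lastVec N ᵥ* transfer N H ^ M) j • (y j - U (y j)) =
          (lastVec N ᵥ* transfer N H ^ M) j • ((2 : ℝ) • b z) +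
          w ((lastVec N ᵥ* transfer N H ^ M) j •
            ∑ i : Fin N, transfer N H j i • (y i - U (y i))) := by
        intro j
        rw [map_smul, hwv, ← smul_add]
        congr 1
        rw [hU.residual_eq hy0 hy j z hz]
        abel
      simp only [e, Finset.sum_add_distrib]
      rw [← Finset.sum_smul, ← map_sum]
      congr 1
      · congr 1
        simp [dotProduct]
      · congr 1
        simp only [Finset.smul_sum, smul_smul]
        rw [Finset.sum_comm]
        refine Finset.sum_congr rfl fun i _ => ?_
        rw [← Finset.sum_smul, pow_succ, ← vecMul_vecMul]
        rfl
  rw [key N, transfer_pow_eq_zero, vecMul_zero]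
  simp

theorem IsSignedShift.pow_apply (hU : IsSignedShift b U) (z : Fin N) (hz : (z : ℕ) = 0) (i : Fin N) :
    ((U.toLinearMap : Module.End ℝ X) ^ (i : ℕ)) (b z) = b i := by
  obtain ⟨i, hi⟩ := i
  induction i with
  | zero => rw [pow_zero]; exact congrArg b (Fin.ext hz)
  | succ i ih =>
    simp only at ih ⊢
    rw [pow_succ', Module.End.mul_apply, ih (by omega)]
    exact hU.succ _ _ rfl

open Polynomial in
/-- The vectors `(U - 1) ^ m b_0`, `m < N`, are linearly independent. -/
theorem IsSignedShift.eq_zero_of_sum_eq_zero (hU : IsSignedShift b U) (z : Fin N)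
    (hz : (z : ℕ) = 0) (a : ℕ → ℝ)
    (h : ∑ m ∈ Finset.range N, a m • ((U.toLinearMap - 1 : Module.End ℝ X) ^ m) (b z) = 0) :
    ∀ m < N, a m = 0 := by
  have hN : 0 < N := z.pos
  set D : ℝ[X] := ∑ m ∈ Finset.range N, C (a m) * (Polynomial.X - 1) ^ m with hD
  have hdeg : D.natDegree < N := by
    refine lt_of_le_of_lt (natDegree_sum_le_of_forall_le (n := N - 1) _ _ fun m hm => ?_) (by omega)
    refine (natDegree_C_mul_le _ _).trans ((natDegree_pow_le).trans ?_)
    rw [show (Polynomial.X - 1 : ℝ[X]) = Polynomial.X - C 1 by simp, natDegree_X_sub_C]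
    rw [Finset.mem_range] at hm
    omega
  have h1 : aeval (U.toLinearMap : Module.End ℝ X) D (b z) = 0 := by
    rw [hD, map_sum, ← h, LinearMap.sum_apply]
    refine Finset.sum_congr rfl fun m _ => ?_
    simp [Algebra.algebraMap_eq_smul_one]
  have hcoeff : ∀ i : Fin N, D.coeff i = 0 := by
    rw [aeval_eq_sum_range' hdeg, LinearMap.sum_apply, ← Fin.sum_univ_eq_sum_range
      (fun i => (D.coeff i • (U.toLinearMap : Module.End ℝ X) ^ i) (b z)) N] at h1
    have h2 : ∑ i : Fin N, D.coeff i • b i = 0 := by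
      rw [← h1]
      refine Finset.sum_congr rfl fun i _ => ?_
      rw [LinearMap.smul_apply, hU.pow_apply z hz i]
    exact Fintype.linearIndependent_iff.1 b.orthonormal.linearIndependent _ h2
  have hD0 : D = 0 := by
    ext i
    rw [coeff_zero]
    by_cases hi : i < N
    · exact hcoeff ⟨i, hi⟩
    · exact coeff_eq_zero_of_natDegree_lt (by omega)
  intro m hm
  have h3 : D.comp (Polynomial.X + 1) = ∑ m ∈ Finset.range N, C (a m) * Polynomial.X ^ m := by
    rw [hD, Polynomial.sum_comp]
    refine Finset.sum_congr rfl fun m _ => ?_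
    simp
  rw [hD0, zero_comp] at h3
  have h4 := congrArg (fun p : ℝ[X] => p.coeff m) h3
  simp [finsetSum_coeff, coeff_C_mul, coeff_X_pow] at h4
  exact (h4 hm).symm

end WorstCase

/-- The space on which worst cases live, in an arbitrary universe. -/
theorem exists_orthonormalBasis_fin (N : ℕ) :
    ∃ (X : Type u) (_ : NormedAddCommGroup X) (_ : InnerProductSpace ℝ X) (_ : CompleteSpace X),
      Nonempty (OrthonormalBasis (Fin N) ℝ X) :=
  ⟨EuclideanSpace ℝ (ULift.{u} (Fin N)), inferInstance, inferInstance, inferInstance,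
    ⟨(EuclideanSpace.basisFun (ULift.{u} (Fin N)) ℝ).reindex Equiv.ulift⟩⟩

/-- The invariants of an optimal matrix: the sums `∑_j Q(m, j; H)` are the coefficients of
`(1 - (1 - z) ^ N) / (N z)`. -/
theorem observed_one_of_mem_optimal {N : ℕ} (hN : 0 < N) {H : HMatrix N}
    (hH : H ∈ optimalHMatrices.{u} N) (m : ℕ) (hm : m < N) :
    (lastVec N ᵥ* transfer N H ^ m) ⬝ᵥ 1 = (N.choose (m + 1) : ℝ) / N := by
  obtain ⟨X, _, _, _, ⟨b⟩⟩ := exists_orthonormalBasis_fin.{u} N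
  obtain ⟨U, hU⟩ := exists_isSignedShift b
  obtain ⟨y, hy0, hy⟩ := exists_isTrajectory N H U (∑ j, b j)
  have hN' : (N : ℝ) ≠ 0 := by exact_mod_cast hN.ne'
  have h1 := hU.last_residual_eq hH hy0 hy hN
  rw [hU.last_residual_expansion hy0 hy ⟨0, hN⟩ rfl] at h1
  have h2 : ∑ j, b j = ∑ m ∈ Finset.range N,
      (N.choose (m + 1) : ℝ) • ((U.toLinearMap - 1 : Module.End ℝ X) ^ m) (b ⟨0, hN⟩) := by
    have := congrArg (fun f : Module.End ℝ X => f (b ⟨0, hN⟩))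
      (geom_sum_eq_sum_choose (U.toLinearMap - 1 : Module.End ℝ X) N)
    simp only [sub_add_cancel, LinearMap.sum_apply] at this
    rw [← Fin.sum_univ_eq_sum_range
      (fun i => ((U.toLinearMap : Module.End ℝ X) ^ i) (b ⟨0, hN⟩)) N] at this
    simp only [hU.pow_apply ⟨0, hN⟩ rfl] at this
    rw [this]
    refine Finset.sum_congr rfl fun m _ => ?_
    rw [← nsmul_eq_mul, LinearMap.smul_apply, Nat.cast_smul_eq_nsmul]
  rw [h2, ← sub_eq_zero, Finset.smul_sum, ← Finset.sum_sub_distrib] at h1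
  have h3 := hU.eq_zero_of_sum_eq_zero ⟨0, hN⟩ rfl
    (fun m => 2 * ((lastVec N ᵥ* transfer N H ^ m) ⬝ᵥ 1) - 2 / N * N.choose (m + 1)) (by
      rw [← h1]
      refine Finset.sum_congr rfl fun m _ => ?_
      rw [map_smul, smul_smul, smul_smul, ← sub_smul, mul_comm (2 : ℝ)]) m hm
  beta_reduce at h3
  field_simp
  field_simp at h3
  linarith

section Folding

open Filter Topology

/-! ### Folding the worst case: nonnegativity of the certificates -/

section Fold

variable {X : Type u} [NormedAddCommGroup X] [InnerProductSpace ℝ X]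

/-- The vector `s` for which `x ↦ x - ⟪x, m⟫ s` is the reflection in the hyperplane `m ^ ⊥`. -/
noncomputable def foldDir (m : X) : X := (2 / ‖m‖ ^ 2 : ℝ) • m

/-- Folding along the hyperplane `m ^ ⊥`: the half space `⟪x, m⟫ ≤ 0` is reflected onto the
other one. -/
noncomputable def fold (m x : X) : X := x - min (inner ℝ x m) 0 • foldDir m

theorem norm_sub_smul_foldDir_sq (m : X) (hm : m ≠ 0) (x : X) (t : ℝ) :
    ‖x - t • foldDir m‖ ^ 2 = ‖x‖ ^ 2 - 4 / ‖m‖ ^ 2 * (t * (inner ℝ x m - t)) := by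
  have hm' : ‖m‖ ≠ 0 := norm_ne_zero_iff.2 hm
  rw [norm_sub_sq_real, foldDir, smul_smul, inner_smul_right, norm_smul, mul_pow,
    Real.norm_eq_abs, sq_abs]
  field_simp
  ring

theorem norm_fold_sub_fold_le (m : X) (hm : m ≠ 0) (x y : X) :
    ‖fold m x - fold m y‖ ≤ ‖x - y‖ := by
  have e : fold m x - fold m y =
      (x - y) - (min (inner ℝ x m) 0 - min (inner ℝ y m) 0) • foldDir m := by
    rw [fold, fold]; module
  rw [e, ← pow_le_pow_iff_left₀ (norm_nonneg _) (norm_nonneg _) two_ne_zero,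
    norm_sub_smul_foldDir_sq m hm, sub_le_self_iff, inner_sub_left]
  refine mul_nonneg (by positivity) ?_
  generalize (inner ℝ x m : ℝ) = a
  generalize (inner ℝ y m : ℝ) = c
  -- both factors have the sign of `a - c`
  rcases le_total a c with h | h
  · refine mul_nonneg_of_nonpos_of_nonpos (sub_nonpos.2 (min_le_min_right 0 h)) ?_
    rcases min_cases a 0 with h1 | h1 <;> rcases min_cases c 0 with h2 | h2 <;> linarith
  · refine mul_nonneg (sub_nonneg.2 (min_le_min_right 0 h)) ?_
    rcases min_cases a 0 with h1 | h1 <;> rcases min_cases c 0 with h2 | h2 <;> linarith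

theorem fold_of_nonneg {m x : X} (h : 0 ≤ (inner ℝ x m : ℝ)) : fold m x = x := by
  rw [fold, min_eq_right h, zero_smul, sub_zero]

theorem fold_of_nonpos {m x : X} (h : (inner ℝ x m : ℝ) ≤ 0) :
    fold m x = x - (inner ℝ x m : ℝ) • foldDir m := by
  rw [fold, min_eq_left h]

theorem norm_fold (m : X) (hm : m ≠ 0) (x : X) : ‖fold m x‖ = ‖x‖ := by
  rcases le_total 0 (inner ℝ x m : ℝ) with h | h
  · rw [fold_of_nonneg h]
  · rw [fold_of_nonpos h, ← sq_eq_sq₀ (norm_nonneg _) (norm_nonneg _),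
      norm_sub_smul_foldDir_sq m hm]
    ring

end Fold

section Independence

variable {N : ℕ} {X : Type u} [NormedAddCommGroup X] [InnerProductSpace ℝ X]
  {b : OrthonormalBasis (Fin N) ℝ X} {U : X →ₗᵢ[ℝ] X}

/-- As the subdiagonal of the transfer matrix does not vanish, the residuals along the worst-case
isometry span the same spaces as the basis vectors. -/
theorem IsSignedShift.basis_mem_span_residual (hU : IsSignedShift b U) {H : HMatrix N}
    (hA : ∀ i k : Fin N, (k : ℕ) = i + 1 → transfer N H k i ≠ 0) {y : ℕ → X}
    (hy0 : y 0 = ∑ j, b j) (hy : IsTrajectory N H U y) (k : ℕ) (hk : k < N) :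
    b ⟨k, hk⟩ ∈ Submodule.span ℝ ((fun j => y j - U (y j)) '' {j : ℕ | j ≤ k}) := by
  set W : ℕ → Submodule ℝ X := fun k =>
    Submodule.span ℝ ((fun j => y j - U (y j)) '' {j : ℕ | j ≤ k}) with hW
  have hmono : ∀ {k l : ℕ}, k ≤ l → W k ≤ W l := fun h =>
    Submodule.span_mono (Set.image_mono fun _ hi => le_trans hi h)
  have hmem : ∀ {j k : ℕ}, j ≤ k → y j - U (y j) ∈ W k := fun {j k} h =>
    Submodule.subset_span ⟨j, h, rfl⟩
  have hstep : ∀ k, k + 1 < N → U (y k - U (y k)) ∈ W (k + 1) := by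
    intro k
    induction k using Nat.strong_induction_on with
    | _ k ih =>
      intro hk
      have hne : ent N H (k + 1) (k + 1) ≠ 0 := by
        have := hA ⟨k, by omega⟩ ⟨k + 1, hk⟩ rfl
        rwa [transfer_apply, Finset.Icc_self, Finset.sum_singleton] at this
      have hyk := hy k (by omega)
      rw [Finset.sum_range_succ] at hyk
      rw [← Submodule.smul_mem_iff _ hne]
      have e : ent N H (k + 1) (k + 1) • U (y k - U (y k)) =
          (y (k + 1) - U (y (k + 1))) - (y k - U (y k))
          + ent N H (k + 1) (k + 1) • (y k - U (y k))
          + ∑ j ∈ Finset.range k, ent N H (k + 1) (j + 1) • (y j - U (y j))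
          - ∑ j ∈ Finset.range k, ent N H (k + 1) (j + 1) • U (y j - U (y j)) := by
        rw [hyk]
        simp only [map_sub, map_add, map_sum, map_smul]
        abel
      rw [e]
      refine sub_mem (add_mem (add_mem (sub_mem (hmem le_rfl) (hmem (Nat.le_succ k)))
        (Submodule.smul_mem _ _ (hmem (Nat.le_succ k)))) (Submodule.sum_mem _ fun j hj => ?_))
        (Submodule.sum_mem _ fun j hj => ?_)
      · rw [Finset.mem_range] at hj
        exact Submodule.smul_mem _ _ (hmem (by omega))
      · rw [Finset.mem_range] at hj
        exact Submodule.smul_mem _ _ (hmono (by omega) (ih j hj (by omega)))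
  have hmap : ∀ k, k + 1 < N → ∀ v ∈ W k, U v ∈ W (k + 1) := by
    intro k hk v hv
    induction hv using Submodule.span_induction with
    | mem x h =>
      obtain ⟨i, hi, rfl⟩ := h
      have hi' : i ≤ k := hi
      exact hmono (by omega) (hstep i (by omega))
    | zero => rw [map_zero]; exact zero_mem _
    | add x y _ _ hx hy => rw [map_add]; exact add_mem hx hy
    | smul a x _ hx => rw [map_smul]; exact Submodule.smul_mem _ _ hx
  show b ⟨k, hk⟩ ∈ W k
  induction k with
  | zero =>
    have h0 : y 0 - U (y 0) = (2 : ℝ) • b ⟨0, hk⟩ := by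
      rw [hy0, hU.map_sum_basis ⟨0, hk⟩ rfl, sub_sub_cancel]
    rw [← Submodule.smul_mem_iff _ (two_ne_zero (α := ℝ)), ← h0]
    exact hmem le_rfl
  | succ k ih =>
    rw [← hU.succ ⟨k, by omega⟩ ⟨k + 1, hk⟩ rfl]
    exact hmap k hk _ (ih (by omega))

/-- The iterates along the worst-case isometry have a dual family. -/
theorem IsSignedShift.exists_dual (hU : IsSignedShift b U) {H : HMatrix N}
    (hA : ∀ i k : Fin N, (k : ℕ) = i + 1 → transfer N H k i ≠ 0) {y : ℕ → X}
    (hy0 : y 0 = ∑ j, b j) (hy : IsTrajectory N H U y) :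
    ∃ d : Fin N → X, ∀ i l : Fin N, inner ℝ (y i) (d l) = if i = l then (1 : ℝ) else 0 := by
  have : FiniteDimensional ℝ X := Module.Finite.of_basis b.toBasis
  have hcard : Fintype.card (Fin N) = Module.finrank ℝ X :=
    (Module.finrank_eq_card_basis b.toBasis).symm
  have hspan : ⊤ ≤ Submodule.span ℝ (Set.range fun j : Fin N => y j - U (y j)) := by
    rw [← b.toBasis.span_eq, Submodule.span_le]
    rintro _ ⟨k, rfl⟩
    rw [b.coe_toBasis]
    refine Submodule.span_mono ?_ (hU.basis_mem_span_residual hA hy0 hy k k.2)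
    rintro _ ⟨j, hj, rfl⟩
    exact ⟨⟨j, lt_of_le_of_lt hj k.2⟩, rfl⟩
  have hlin' := linearIndependent_of_top_le_span_of_card_eq_finrank hspan hcard
  have hlin : LinearIndependent ℝ fun j : Fin N => y j := by
    refine LinearIndependent.of_comp (LinearMap.id - U.toLinearMap : X →ₗ[ℝ] X) ?_
    exact hlin'
  obtain ⟨B, hB⟩ : ∃ B : Module.Basis (Fin N) ℝ X, ∀ i : Fin N, B i = y i :=
    ⟨Module.Basis.mk hlin (hlin.span_eq_top_of_card_eq_finrank' hcard).ge,
      fun i => Module.Basis.mk_apply _ _ i⟩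
  refine ⟨fun l => (InnerProductSpace.toDual ℝ X).symm
    (LinearMap.toContinuousLinearMap (B.coord l)), fun i l => ?_⟩
  rw [real_inner_comm, InnerProductSpace.toDual_symm_apply, LinearMap.coe_toContinuousLinearMap',
    ← hB, Module.Basis.coord_apply, Module.Basis.repr_self, Finsupp.single_apply]

end Independence

section Perturbation

variable {N : ℕ} {X : Type u} [NormedAddCommGroup X] [InnerProductSpace ℝ X]
  {b : OrthonormalBasis (Fin N) ℝ X} {U : X →ₗᵢ[ℝ] X}

/-- First-order response of the iterates to a displacement of the `k`-th iterate before the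
application of `U`, as linear functions of the displacement. -/
noncomputable def sensitivity (N : ℕ) (H : HMatrix N) (U : X →L[ℝ] X) (k : ℕ) : ℕ → X →L[ℝ] X :=
  stepSeq (fun i j => ent N H (i + 1) (j + 1))
    (fun j V => V - U.comp V - if j = k then U else 0) 0

theorem sensitivity_eq_zero (H : HMatrix N) (U : X →L[ℝ] X) (k i : ℕ) (h : i ≤ k) :
    sensitivity N H U k i = 0 := by
  induction i using Nat.strong_induction_on with
  | _ i ih =>
    rcases i with _ | i
    · exact stepSeq_zero _ _ _
    · have e : ∀ j, j ≤ i → stepSeq (fun i j => ent N H (i + 1) (j + 1))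
          (fun j V => V - U.comp V - if j = k then U else 0) 0 j = 0 :=
        fun j hj => ih j (by omega) (by omega)
      rw [sensitivity, stepSeq_succ, e i le_rfl, zero_sub, neg_eq_zero]
      refine Finset.sum_eq_zero fun j hj => ?_
      rw [Finset.mem_range] at hj
      rw [e j (by omega), if_neg (by omega)]
      simp

theorem sensitivity_succ (H : HMatrix N) (U : X →L[ℝ] X) (k i : ℕ) (s : X) :
    sensitivity N H U k (i + 1) s = sensitivity N H U k i s -
      ∑ j ∈ Finset.range (i + 1), ent N H (i + 1) (j + 1) •
        (sensitivity N H U k j s - U (sensitivity N H U k j s) - if j = k then U s else 0) := by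
  unfold sensitivity
  rw [stepSeq_succ, _root_.sub_apply, _root_.sum_apply]
  congr 1
  refine Finset.sum_congr rfl fun j _ => ?_
  split_ifs <;> simp

/-- The performance bound for the fold composed with the worst-case isometry, when only the `k`-th
iterate lies on the folded side. All monotonicity expressions except those involving `k` vanish,
and the bound becomes a bound on the `k`-th row of the Lyapunov solution. -/
theorem IsSignedShift.fold_bound [CompleteSpace X] (hU : IsSignedShift b U) {H : HMatrix N}
    (hH : H ∈ optimalHMatrices.{u} N) {y : ℕ → X} (hy0 : y 0 = ∑ j, b j)
    (hy : IsTrajectory N H U y) (k n : Fin N) (hn : (n : ℕ) + 1 = N) (m : X) (hm : m ≠ 0)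
    (ε : ℝ) (hε : 0 < ε) (hk : inner ℝ (y k) m = -ε)
    (hpos : ∀ i : Fin N, i ≠ k → 0 ≤ (inner ℝ
      (y i + ε • sensitivity N H U.toContinuousLinearMap k i (foldDir m)) m : ℝ)) :
    ∑ i : Fin N, lyap (transfer N H) (lastVec N) N k i * (if i = k then 0 else
      inner ℝ (y i + ε • sensitivity N H U.toContinuousLinearMap k i (foldDir m)) m) ≤
    ε / 8 * ‖sensitivity N H U.toContinuousLinearMap k n (foldDir m) -
      U (sensitivity N H U.toContinuousLinearMap k n (foldDir m)) -
      if n = k then U (foldDir m) else 0‖ ^ 2 * ‖m‖ ^ 2 := by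
  have hN : 0 < N := n.pos
  have hN' : (0 : ℝ) < N := by exact_mod_cast hN
  have hm' : (0 : ℝ) < ‖m‖ ^ 2 := by positivity
  have hLk : sensitivity N H U.toContinuousLinearMap k k (foldDir m) = 0 := by
    rw [sensitivity_eq_zero H _ _ _ le_rfl]; rfl
  have hLrec := fun i => sensitivity_succ H U.toContinuousLinearMap k i (foldDir m)
  have hL0 : sensitivity N H U.toContinuousLinearMap k 0 (foldDir m) = 0 := by
    rw [sensitivity_eq_zero H _ _ _ (Nat.zero_le _)]; rfl
  generalize hL : (fun i => sensitivity N H U.toContinuousLinearMap k i (foldDir m)) = L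
  have hL' : ∀ i, sensitivity N H U.toContinuousLinearMap k i (foldDir m) = L i :=
    fun i => congrFun hL i
  simp only [hL', LinearIsometry.coe_toContinuousLinearMap] at hLk hLrec hL0 hpos ⊢
  clear hL hL'
  generalize hz : (fun i => y i + ε • L i) = z
  have hz' : ∀ i, y i + ε • L i = z i := fun i => congrFun hz i
  simp only [hz'] at hpos ⊢
  have hzk : z k = y k := by rw [← hz', hLk, smul_zero, add_zero]
  have hz0 : z 0 = y 0 := by rw [← hz', hL0, smul_zero, add_zero]
  let T : X → X := fun x => U (fold m x)
  have hT : ∀ i : Fin N, T (z i) = U (z i + if i = k then ε • foldDir m else 0) := by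
    intro i
    show U (fold m (z i)) = _
    congr 1
    split_ifs with h
    · rw [h, hzk, fold_of_nonpos (by rw [hk]; linarith), hk, neg_smul, sub_neg_eq_add]
    · rw [fold_of_nonneg (hpos i h), add_zero]
  have hres : ∀ i : Fin N, z i - T (z i) = (y i - U (y i)) +
      ε • (L i - U (L i) - if i = k then U (foldDir m) else 0) := by
    intro i
    rw [hT i, ← hz']
    split_ifs
    · simp only [map_add, map_smul]; module
    · simp only [map_add, map_smul, map_zero]; module
  have hnonexp : ∀ x x' : X, ‖T x - T x'‖ ≤ ‖x - x'‖ := fun x x' => by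
    show ‖U (fold m x) - U (fold m x')‖ ≤ _
    rw [← map_sub, LinearIsometry.norm_map]
    exact norm_fold_sub_fold_le m hm x x'
  have hT0 : T 0 = 0 := by
    show U (fold m 0) = 0
    rw [fold_of_nonneg (by simp), map_zero]
  have htraj : IsTrajectory N H T z := by
    intro i hi
    have e : ∀ j ∈ Finset.range (i + 1), ent N H (i + 1) (j + 1) • (z j - T (z j)) =
        ent N H (i + 1) (j + 1) • (y j - U (y j)) + ε • ent N H (i + 1) (j + 1) •
          (L j - U (L j) - if j = k then U (foldDir m) else 0) := by
      intro j hj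
      rw [Finset.mem_range] at hj
      have := hres ⟨j, by omega⟩
      simp only [Fin.ext_iff] at this
      rw [this, smul_add, smul_comm ε]
    rw [Finset.sum_congr rfl e, Finset.sum_add_distrib, ← Finset.smul_sum, ← hz', ← hz', hy i hi,
      hLrec i, smul_sub]
    abel
  have hopt := hH.2 X T hnonexp 0 hT0 z htraj
  have hlast := hU.last_residual_eq hH hy0 hy hN
  have hn1 : N - 1 = (n : ℕ) := by omega
  rw [hn1] at hlast hopt
  rw [sub_zero, hz0, le_div_iff₀ (by positivity)] at hopt
  have hrec := sum_ent_recursion N H z (fun j => z j - T (z j)) htraj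
  have key := energy_identity (transfer N H) _
    (lyap_equation _ (lastVec N) N hN (transfer_pow_eq_zero N H)) (lyap_transpose _ _ N)
    (lyap_mulVec_one _ _ N hN (observed_one_of_mem_optimal hN hH))
    (fun i => z i - T (z i)) (fun i => z i - (1 / 2 : ℝ) • (z i - T (z i))) (y 0)
    (fun l => by
      show z l - (1 / 2 : ℝ) • (z l - T (z l)) =
        y 0 - ∑ j, transfer N H l j • (z j - T (z j)) - (1 / 2 : ℝ) • (z l - T (z l))
      rw [← hz0, ← hrec l]) n hn
  have hFt : ∀ i l, lyap (transfer N H) (lastVec N) N i l =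
      lyap (transfer N H) (lastVec N) N l i := fun i l =>
    congrFun (congrFun (lyap_transpose (transfer N H) (lastVec N) N) l) i
  generalize lyap (transfer N H) (lastVec N) N = F at key hFt ⊢
  have hzero : inner ℝ (z n - T (z n)) (z n - (1 / 2 : ℝ) • (z n - T (z n))) = (0 : ℝ) := by
    have := inner_residual_sub (z n) 0 (T (z n)) 0
    simp only [sub_zero, smul_zero] at this
    rw [this]
    have : ‖T (z n)‖ = ‖z n‖ := by
      show ‖U (fold m (z n))‖ = _
      rw [LinearIsometry.norm_map, norm_fold m hm]
    rw [this, sub_self, zero_div]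
  -- the monotonicity expressions of the folded isometry
  let q : Fin N → ℝ := fun i => if i = k then 0 else inner ℝ (z i) m
  have hqk : ∀ i : Fin N, i ≠ k →
      ‖z k + ε • foldDir m - z i‖ ^ 2 = ‖z k - z i‖ ^ 2 - 4 * ε / ‖m‖ ^ 2 * q i := by
    intro i hi
    have e : z k + ε • foldDir m - z i = (z k - z i) - (-ε) • foldDir m := by module
    rw [e, norm_sub_smul_foldDir_sq m hm, inner_sub_left, hzk, hk]
    simp only [q, if_neg hi]
    ring
  have hineq : ∀ i l : Fin N, inner ℝ ((z i - T (z i)) - (z l - T (z l)))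
      ((z i - (1 / 2 : ℝ) • (z i - T (z i))) - (z l - (1 / 2 : ℝ) • (z l - T (z l)))) =
      2 * ε / ‖m‖ ^ 2 * ((if i = k then q l else 0) + (if l = k then q i else 0)) := by
    intro i l
    rw [inner_residual_sub, hT i, hT l, ← map_sub, LinearIsometry.norm_map]
    by_cases hi : i = k <;> by_cases hl : l = k
    · subst hi; subst hl; simp [q]
    · subst hi
      rw [if_pos rfl, if_neg hl, if_pos rfl, if_neg hl, add_zero, hqk l hl]
      ring
    · subst hl
      rw [if_pos rfl, if_neg hi, if_pos rfl, if_neg hi, add_zero, norm_sub_rev (z i) _,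
        norm_sub_rev (z i) _, hqk i hi]
      ring
    · simp [hi, hl]
  have hsum : ∑ i : Fin N, ∑ l : Fin N, F i l * inner ℝ ((z i - T (z i)) - (z l - T (z l)))
      ((z i - (1 / 2 : ℝ) • (z i - T (z i))) - (z l - (1 / 2 : ℝ) • (z l - T (z l)))) =
      4 * ε / ‖m‖ ^ 2 * ∑ i, F k i * q i := by
    have e1 : ∑ i : Fin N, ∑ l : Fin N, F i l * (if i = k then q l else 0) =
        ∑ i, F k i * q i := by
      rw [Finset.sum_eq_single k]
      · simp
      · intro i _ hi; simp [hi]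
      · intro h; exact absurd (Finset.mem_univ _) h
    have e2 : ∑ i : Fin N, ∑ l : Fin N, F i l * (if l = k then q i else 0) =
        ∑ i, F k i * q i := by
      rw [Finset.sum_comm, ← e1]
      exact Finset.sum_congr rfl fun i _ => Finset.sum_congr rfl fun l _ => by rw [hFt]
    simp only [hineq]
    simp only [mul_left_comm (F _ _), ← Finset.mul_sum]
    simp only [mul_add, Finset.sum_add_distrib]
    rw [e1, e2]
    ring
  have hsq : y 0 - (N / 2 : ℝ) • (z n - T (z n)) =
      -((N / 2 * ε : ℝ) • (L n - U (L n) - if n = k then U (foldDir m) else 0)) := by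
    rw [hres n, hlast, ← hy0, smul_add, smul_smul, smul_smul]
    have : (N / 2 * (2 / N) : ℝ) = 1 := by field_simp
    rw [this, one_smul]
    abel
  rw [hsum, hzero, hsq, norm_neg, norm_smul, mul_pow, Real.norm_eq_abs, sq_abs] at key
  show ∑ i, F k i * q i ≤ _
  generalize ‖L n - U (L n) - if n = k then U (foldDir m) else 0‖ ^ 2 = R at key ⊢
  have h1 : 0 ≤ (N / 2 * ε : ℝ) ^ 2 * R + N * 0
      - (N : ℝ) ^ 2 / 2 * (4 * ε / ‖m‖ ^ 2 * ∑ i, F k i * q i) := by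
    rw [← key]
    linarith
  generalize ∑ i, F k i * q i = S at h1 ⊢
  generalize ‖m‖ ^ 2 = M at h1 hm' ⊢
  have h2 : (N / 2 * ε : ℝ) ^ 2 * R + N * 0 - (N : ℝ) ^ 2 / 2 * (4 * ε / M * S) =
      2 * (N : ℝ) ^ 2 * ε / M * (ε / 8 * R * M - S) := by
    field_simp
    ring
  rw [h2] at h1
  exact sub_nonneg.1 (nonneg_of_mul_nonneg_right h1 (by positivity))

end Perturbation

/-- The H-certificates of an optimal matrix are nonnegative. For `j < k`, the worst-case isometry
is folded along a hyperplane that contains the iterates before `k` other than `j`, leaves `j` on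
the one side and puts `k` on the other at distance of order `η ^ 2`, while later iterates are at
distance of order `η` on the side of `j`. As `η → 0` the bound for the folded isometry yields the
sign of the entry `(k, j)` of the Lyapunov solution. -/
theorem lyap_nonpos_of_mem_optimal {N : ℕ} {H : HMatrix N}
    (hH : H ∈ optimalHMatrices.{u} N) (k j : Fin N) (hjk : j < k) :
    lyap (transfer N H) (lastVec N) N k j ≤ 0 := by
  have hN : 0 < N := k.pos
  obtain ⟨X, _, _, _, ⟨b⟩⟩ := exists_orthonormalBasis_fin.{u} N
  obtain ⟨U, hU⟩ := exists_isSignedShift b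
  obtain ⟨y, hy0, hy⟩ := exists_isTrajectory N H U (∑ j, b j)
  have hA : ∀ i k : Fin N, (k : ℕ) = i + 1 → transfer N H k i ≠ 0 := by
    refine fun i k h => subdiagonal_ne_zero (transfer_eq_zero N H) ?_ i k h
    rw [observed_one_of_mem_optimal hN hH _ (by omega), Nat.sub_add_cancel hN, Nat.choose_self]
    positivity
  obtain ⟨d, hd⟩ := hU.exists_dual hA hy0 hy
  let n : Fin N := ⟨N - 1, by omega⟩
  have hn : (n : ℕ) + 1 = N := by show N - 1 + 1 = N; omega
  let m : ℝ → X := fun η => d j + η • ∑ i ∈ Finset.Ioi k, d i - η ^ 2 • d k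
  let L := sensitivity N H U.toContinuousLinearMap k
  have hm : ∀ η, ∀ i : Fin N, inner ℝ (y i) (m η) =
      (if i = j then 1 else 0) + η * (if k < i then 1 else 0) - η ^ 2 * (if i = k then 1 else 0) := by
    intro η i
    simp only [m, inner_sub_right, inner_add_right, inner_smul_right, inner_sum, hd]
    simp
  have hm0 : m 0 = d j := by simp [m]
  have hmne : ∀ η, m η ≠ 0 := by
    intro η h
    have := hm η j
    rw [h, inner_zero_right] at this
    simp [hjk.ne, hjk.not_gt] at this
  have hmc : Continuous m := by fun_prop
  have hsc : Continuous fun η => foldDir (m η) := by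
    unfold foldDir
    refine Continuous.smul (Continuous.div continuous_const (by fun_prop) fun η => ?_) hmc
    have := norm_ne_zero_iff.2 (hmne η)
    positivity
  have hLc : ∀ i : ℕ, Continuous fun η => L i (foldDir (m η)) := fun i =>
    (L i).continuous.comp hsc
  have hlater : ∀ i : Fin N, k < i → ∀ η, inner ℝ (y i + η ^ 2 • L i (foldDir (m η))) (m η) =
      η * (1 + η * inner ℝ (L i (foldDir (m η))) (m η)) := by
    intro i hi η
    rw [inner_add_left, hm, inner_smul_left, if_neg (hjk.trans hi).ne', if_pos hi, if_neg hi.ne']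
    simp only [conj_trivial]
    ring
  have hearlier : ∀ i : Fin N, i < k → ∀ η, inner ℝ (y i + η ^ 2 • L i (foldDir (m η))) (m η) =
      if i = j then (1 : ℝ) else 0 := by
    intro i hi η
    have hL0 : L i = 0 := sensitivity_eq_zero H _ _ _ (by rw [Fin.lt_def] at hi; omega)
    rw [hL0, _root_.zero_apply, smul_zero, add_zero, hm, if_neg hi.not_gt,
      if_neg hi.ne]
    ring
  have hpos : ∀ᶠ η in 𝓝[>] (0 : ℝ), ∀ i : Fin N, i ≠ k →
      0 ≤ (inner ℝ (y i + η ^ 2 • L i (foldDir (m η))) (m η) : ℝ) := by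
    rw [eventually_all]
    intro i
    rcases lt_trichotomy i k with hi | hi | hi
    · filter_upwards with η _
      rw [hearlier i hi]
      split_ifs <;> norm_num
    · filter_upwards with η h
      exact absurd hi h
    · have hc : Continuous fun η => 1 + η * (inner ℝ (L i (foldDir (m η))) (m η) : ℝ) :=
        continuous_const.add (continuous_id.mul ((hLc i).inner hmc))
      have : ∀ᶠ η in 𝓝 (0 : ℝ), 0 < 1 + η * (inner ℝ (L i (foldDir (m η))) (m η) : ℝ) :=
        hc.continuousAt.eventually (lt_mem_nhds (by simp))
      filter_upwards [this.filter_mono nhdsWithin_le_nhds, self_mem_nhdsWithin] with η h1 h2 _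
      rw [hlater i hi]
      exact mul_nonneg (le_of_lt h2) h1.le
  let f : ℝ → ℝ := fun η => ∑ i : Fin N, lyap (transfer N H) (lastVec N) N k i *
    (if i = k then 0 else inner ℝ (y i + η ^ 2 • L i (foldDir (m η))) (m η))
  let g : ℝ → ℝ := fun η => η ^ 2 / 8 * ‖L n (foldDir (m η)) - U (L n (foldDir (m η))) -
    if n = k then U (foldDir (m η)) else 0‖ ^ 2 * ‖m η‖ ^ 2
  have hfg : ∀ᶠ η in 𝓝[>] (0 : ℝ), f η ≤ g η := by
    filter_upwards [hpos, self_mem_nhdsWithin] with η h1 h2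
    have h2' : 0 < η := h2
    refine hU.fold_bound hH hy0 hy k n hn (m η) (hmne η) (η ^ 2) (by positivity) ?_ h1
    rw [hm, if_neg hjk.ne', if_neg (lt_irrefl k), if_pos rfl]
    ring
  have hf : Continuous f := by
    refine continuous_finsetSum _ fun i _ => continuous_const.mul ?_
    split_ifs
    · exact continuous_const
    · exact (continuous_const.add ((continuous_pow 2).smul (hLc i))).inner hmc
  have hg : Continuous g := by
    refine (((continuous_pow 2).div_const 8).mul (Continuous.pow (Continuous.norm ?_) 2)).mul
      (hmc.norm.pow 2)
    refine ((hLc n).sub (U.continuous.comp (hLc n))).sub ?_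
    split_ifs
    · exact U.continuous.comp hsc
    · exact continuous_const
  have hlim : f 0 ≤ g 0 := le_of_tendsto_of_tendsto
    (hf.continuousAt.mono_left nhdsWithin_le_nhds) (hg.continuousAt.mono_left nhdsWithin_le_nhds) hfg
  have hf0 : f 0 = lyap (transfer N H) (lastVec N) N k j := by
    simp only [f]
    rw [Finset.sum_eq_single j]
    · rw [if_neg hjk.ne, hearlier j hjk, if_pos rfl, mul_one]
    · intro i _ hi
      rcases lt_trichotomy i k with h | h | h
      · rw [hearlier i h, if_neg hi]; simp
      · simp [h]
      · rw [hlater i h]; simp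
    · intro h; exact absurd (Finset.mem_univ _) h
  have hg0 : g 0 = 0 := by simp [g]
  rwa [hf0, hg0] at hlim

theorem isCertified_of_mem_optimal {N : ℕ} (hN : 0 < N) {H : HMatrix N}
    (hH : H ∈ optimalHMatrices.{u} N) : IsCertified N H :=
  ⟨hH.1, lyap_mulVec_one _ _ N hN (observed_one_of_mem_optimal hN hH),
    lyap_nonpos_of_mem_optimal hH⟩

end Folding

/-! ### The Lyapunov equation of a glued matrix -/

section Blocks

variable {ι κ : Type*} [Fintype ι] [Fintype κ]

/-- The solution of the Lyapunov equation for the block lower triangular matrix with diagonal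
blocks `A₁`, `A₂` and off-diagonal block `c 1 (e₁ᵀ A₁) + u e₁ᵀ`, where `u = c (p 1 - A₂ 1)`. -/
theorem lyapunov_fromBlocks (A₁ F₁ : Matrix ι ι ℝ) (A₂ F₂ : Matrix κ κ ℝ) (e₁ : ι → ℝ) (e₂ : κ → ℝ)
    (c p : ℝ) (hp : p ≠ 0)
    (h₁ : F₁ + A₁ᵀ * F₁ + F₁ * A₁ = vecMulVec e₁ e₁)
    (h₂ : F₂ + A₂ᵀ * F₂ + F₂ * A₂ = vecMulVec e₂ e₂)
    (hF₂ : F₂ᵀ = F₂) (hrow : F₂ *ᵥ 1 = (1 / p) • e₂) (he₂ : e₂ ⬝ᵥ 1 = 1)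
    (heA : e₂ ⬝ᵥ (A₂ *ᵥ 1) = (p - 1) / 2) (u : κ → ℝ)
    (hu : u = c • (p • (1 : κ → ℝ) - A₂ *ᵥ 1)) :
    fromBlocks (c ^ 2 • (F₁ + (1 / p) • vecMulVec e₁ e₁)) (-(c / p) • vecMulVec e₁ e₂)
        (-(c / p) • vecMulVec e₂ e₁) F₂ +
      (fromBlocks A₁ 0 (c • vecMulVec 1 (e₁ ᵥ* A₁) + vecMulVec u e₁) A₂)ᵀ *
        fromBlocks (c ^ 2 • (F₁ + (1 / p) • vecMulVec e₁ e₁)) (-(c / p) • vecMulVec e₁ e₂)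
          (-(c / p) • vecMulVec e₂ e₁) F₂ +
      fromBlocks (c ^ 2 • (F₁ + (1 / p) • vecMulVec e₁ e₁)) (-(c / p) • vecMulVec e₁ e₂)
          (-(c / p) • vecMulVec e₂ e₁) F₂ *
        fromBlocks A₁ 0 (c • vecMulVec 1 (e₁ ᵥ* A₁) + vecMulVec u e₁) A₂ =
      fromBlocks 0 0 0 (vecMulVec e₂ e₂) := by
  have hFu : F₂ *ᵥ u = (c / p) • (e₂ + e₂ ᵥ* A₂) := by
    have h := congrArg (fun M => M *ᵥ (1 : κ → ℝ)) h₂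
    simp only [add_mulVec, ← mulVec_mulVec, hrow, mulVec_smul, mulVec_transpose] at h
    have h3 : vecMulVec e₂ e₂ *ᵥ (1 : κ → ℝ) = e₂ := by
      ext i
      have : (vecMulVec e₂ e₂ *ᵥ (1 : κ → ℝ)) i = e₂ i * (e₂ ⬝ᵥ 1) := by
        simp [mulVec, dotProduct, vecMulVec_apply, Finset.mul_sum]
      rw [this, he₂, mul_one]
    rw [h3] at h
    have h4 : F₂ *ᵥ (A₂ *ᵥ 1) = e₂ - (1 / p) • e₂ - (1 / p) • (e₂ ᵥ* A₂) := by
      ext i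
      have hi := congrFun h i
      simp only [Pi.add_apply, Pi.sub_apply] at hi ⊢
      linarith
    rw [hu, mulVec_smul, mulVec_sub, mulVec_smul, hrow, h4]
    ext i
    simp only [Pi.smul_apply, Pi.sub_apply, Pi.add_apply, smul_eq_mul]
    field_simp
    ring
  have heu : e₂ ⬝ᵥ u = c * ((p + 1) / 2) := by
    rw [hu, dotProduct_smul, dotProduct_sub, dotProduct_smul, he₂, heA]
    simp only [smul_eq_mul]
    ring
  generalize hB : c • vecMulVec 1 (e₁ ᵥ* A₁) + vecMulVec u e₁ = B
  have hB₁ : e₂ ᵥ* B = c • (e₁ ᵥ* A₁) + (c * ((p + 1) / 2)) • e₁ := by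
    rw [← hB, vecMul_add, vecMul_smul, vecMul_vecMulVec, vecMul_vecMulVec, he₂, heu, one_smul]
  have hB₂ : F₂ * B = (c / p) • (vecMulVec e₂ (e₁ ᵥ* A₁) + vecMulVec (e₂ + e₂ ᵥ* A₂) e₁) := by
    rw [← hB, Matrix.mul_add, Matrix.mul_smul, mul_vecMulVec, mul_vecMulVec, hFu, hrow]
    ext i j
    simp only [Matrix.add_apply, Matrix.smul_apply, vecMulVec_apply, Pi.smul_apply, Pi.add_apply,
      smul_eq_mul]
    ring
  have hB₃ : Bᵀ * F₂ = (c / p) • (vecMulVec (e₁ ᵥ* A₁) e₂ + vecMulVec e₁ (e₂ + e₂ ᵥ* A₂)) := by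
    have := congrArg transpose hB₂
    rwa [transpose_mul, hF₂, transpose_smul, transpose_add, transpose_vecMulVec,
      transpose_vecMulVec] at this
  rw [fromBlocks_transpose, fromBlocks_multiply, fromBlocks_multiply, fromBlocks_add,
    fromBlocks_add, hB₂, hB₃]
  congr 1
  · ext i j
    have := congrFun (congrFun h₁ i) j
    simp only [Matrix.add_apply, vecMulVec_apply] at this
    simp only [Matrix.mul_add, Matrix.add_mul,
      Matrix.mul_smul, Matrix.smul_mul, mul_vecMulVec, vecMulVec_mul, mulVec_transpose, hB₁,
      Matrix.add_apply, Matrix.smul_apply, vecMulVec_apply, Pi.smul_apply, Pi.add_apply,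
      smul_eq_mul, Matrix.zero_apply]
    have e : (F₁ * A₁) i j = e₁ i * e₁ j - F₁ i j - (A₁ᵀ * F₁) i j := by linarith
    rw [e]
    field_simp
    ring
  · ext i j
    simp only [Matrix.mul_zero, Matrix.mul_smul, Matrix.smul_mul, mul_vecMulVec, vecMulVec_mul,
      mulVec_transpose, Matrix.add_apply, Matrix.smul_apply, vecMulVec_apply, Pi.add_apply,
      smul_eq_mul, Matrix.zero_apply]
    ring
  · ext i j
    simp only [transpose_zero, Matrix.zero_mul, Matrix.mul_smul, Matrix.smul_mul, mul_vecMulVec,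
      vecMulVec_mul, mulVec_transpose, Matrix.add_apply, Matrix.smul_apply, vecMulVec_apply,
      Pi.add_apply, smul_eq_mul, Matrix.zero_apply]
    ring
  · rw [← h₂]
    simp

end Blocks

/-! ### The transfer matrix of a gluing -/

/-- The conditions on the entries of a gluing except those on the column `N'` below the
diagonal. -/
structure IsGluingBlocks (N N' : ℕ) (H₁ : HMatrix N') (H₂ : HMatrix (N - N')) (H : HMatrix N) :
    Prop where
  upper_left : ∀ k j : ℕ, 1 ≤ k → k ≤ N' - 1 → 1 ≤ j → j ≤ N' - 1 →
    ent N H k j = ent N' H₁ k j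
  upper_right : ∀ k j : ℕ, k ≤ N' → N' ≤ j → k < j → ent N H k j = 0
  lower_left : ∀ k j : ℕ, N' + 1 ≤ k → j ≤ N' - 1 → ent N H k j = 0
  lower_right : ∀ k j : ℕ, 1 ≤ k → k ≤ N - N' - 1 → 1 ≤ j → j ≤ N - N' - 1 →
    ent N H (N' + k) (N' + j) = ent (N - N') H₂ k j
  middle_row : ∀ j : ℕ, 1 ≤ j → j ≤ N' - 1 →
    ent N H N' j = -(((N : ℝ) - N') / N) * ∑ k ∈ Finset.Icc j (N' - 1), ent N' H₁ k j

theorem IsGluing.toBlocks {N N' : ℕ} {H₁ : HMatrix N'} {H₂ : HMatrix (N - N')} {H : HMatrix N}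
    (h : IsGluing N N' H₁ H₂ H) : IsGluingBlocks N N' H₁ H₂ H :=
  ⟨h.upper_left, h.upper_right, h.lower_left, h.lower_right, h.middle_row⟩

theorem ent_apply (N : ℕ) (H : HMatrix N) (i j : Fin (N - 1)) :
    ent N H (i + 1) (j + 1) = H i j := by
  have hi := i.2
  have hj := j.2
  rw [ent, dif_pos ⟨⟨by omega, by omega⟩, ⟨by omega, by omega⟩⟩]
  rfl

theorem ent_eq_zero_of_lower {N : ℕ} {H : HMatrix N} (h : _root_.IsLowerTriangular H) {k j : ℕ}
    (hkj : k < j) : ent N H k j = 0 := by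
  rw [ent]
  split_ifs with hr
  · exact h _ _ (by rw [Fin.lt_def]; show k - 1 < j - 1; omega)
  · rfl

theorem IsGluingBlocks.lowerTriangular {N N' : ℕ} {H₁ : HMatrix N'} {H₂ : HMatrix (N - N')}
    {H : HMatrix N} (h : IsGluingBlocks N N' H₁ H₂ H) (h₁ : _root_.IsLowerTriangular H₁)
    (h₂ : _root_.IsLowerTriangular H₂) : _root_.IsLowerTriangular H := by
  intro i j hij
  have hi := i.2
  have hj := j.2
  rw [Fin.lt_def] at hij
  rw [← ent_apply N H]
  by_cases hk : (i : ℕ) + 1 ≤ N'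
  · by_cases hj' : N' ≤ (j : ℕ) + 1
    · exact h.upper_right _ _ hk hj' (by omega)
    · rw [h.upper_left _ _ (by omega) (by omega) (by omega) (by omega)]
      exact ent_eq_zero_of_lower h₁ (by omega)
  · obtain ⟨k, hk⟩ : ∃ k, (i : ℕ) + 1 = N' + k := ⟨i + 1 - N', by omega⟩
    obtain ⟨l, hl⟩ : ∃ l, (j : ℕ) + 1 = N' + l := ⟨j + 1 - N', by omega⟩
    rw [hk, hl, h.lower_right _ _ (by omega) (by omega) (by omega) (by omega)]
    exact ent_eq_zero_of_lower h₂ (by omega)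

/-- A lower triangular step-size matrix is determined by its transfer matrix. -/
theorem transfer_injective {N : ℕ} {H H' : HMatrix N} (h : _root_.IsLowerTriangular H)
    (h' : _root_.IsLowerTriangular H') (he : transfer N H = transfer N H') : H = H' := by
  have key : ∀ G : HMatrix N, ∀ i j : Fin (N - 1), j ≤ i →
      G i j = transfer N G ⟨i + 1, by omega⟩ ⟨j, by omega⟩ -
        transfer N G ⟨i, by omega⟩ ⟨j, by omega⟩ := by
    intro G i j hji
    rw [Fin.le_def] at hji
    rw [transfer_apply, transfer_apply]
    simp only
    rw [Finset.sum_Icc_succ_top (by omega), ent_apply]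
    ring
  ext i j
  by_cases hij : j ≤ i
  · rw [key H i j hij, key H' i j hij, he]
  · rw [h i j (not_le.1 hij), h' i j (not_le.1 hij)]

/-- The nodes of a gluing as the disjoint union of the nodes of its parts. -/
def glueEquiv {N N' : ℕ} (h : N' ≤ N) : Fin N' ⊕ Fin (N - N') ≃ Fin N :=
  finSumFinEquiv.trans (finCongr (by omega))

@[simp] theorem glueEquiv_inl {N N' : ℕ} (h : N' ≤ N) (i : Fin N') :
    (glueEquiv h (Sum.inl i) : ℕ) = i := rfl

@[simp] theorem glueEquiv_inr {N N' : ℕ} (h : N' ≤ N) (i : Fin (N - N')) :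
    (glueEquiv h (Sum.inr i) : ℕ) = N' + i := rfl

section Glue

variable {N N' : ℕ} {H₁ : HMatrix N'} {H₂ : HMatrix (N - N')} {H : HMatrix N}

/-- The column of the transfer matrix at the last node of the first part, below this node. -/
noncomputable def glueColumn (N N' : ℕ) (H : HMatrix N) : Fin (N - N') → ℝ :=
  fun q => ∑ i ∈ Finset.Icc N' (N' + q), ent N H i N'

theorem IsGluingBlocks.transfer_eq (h : IsGluingBlocks N N' H₁ H₂ H) (h1 : 1 ≤ N') (hle : N' ≤ N) :
    (transfer N H).submatrix (glueEquiv hle) (glueEquiv hle) =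
      fromBlocks (transfer N' H₁) 0
        ((N' / N : ℝ) • vecMulVec 1 (lastVec N' ᵥ* transfer N' H₁) +
          vecMulVec (glueColumn N N' H) (lastVec N')) (transfer (N - N') H₂) := by
  ext i j
  rcases i with i | i <;> rcases j with j | j
  · rw [submatrix_apply, fromBlocks_apply₁₁, transfer_apply, transfer_apply, glueEquiv_inl,
      glueEquiv_inl]
    have hi := i.2
    refine Finset.sum_congr rfl fun k hk => ?_
    rw [Finset.mem_Icc] at hk
    exact h.upper_left _ _ (by omega) (by omega) (by omega) (by omega)
  · rw [submatrix_apply, fromBlocks_apply₁₂]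
    exact transfer_eq_zero _ _ _ _ (by rw [Fin.le_def, glueEquiv_inl, glueEquiv_inr]; omega)
  · have hlast : (lastVec N' ᵥ* transfer N' H₁) j =
        ∑ i ∈ Finset.Icc ((j : ℕ) + 1) (N' - 1), ent N' H₁ i (j + 1) :=
      lastVec_dotProduct (⟨N' - 1, by omega⟩ : Fin N') (by show N' - 1 + 1 = N'; omega)
        (fun k => transfer N' H₁ k j)
    rw [submatrix_apply, fromBlocks_apply₂₁, Matrix.add_apply, Matrix.smul_apply, vecMulVec_apply,
      vecMulVec_apply, hlast, transfer_apply, glueEquiv_inl, glueEquiv_inr]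
    have hj := j.2
    by_cases hj' : (j : ℕ) + 1 = N'
    · rw [lastVec, if_pos hj', hj', Finset.Icc_eq_empty (a := N') (b := N' - 1) (by omega)]
      simp [glueColumn]
    · rw [lastVec, if_neg hj']
      have hsplit : ∑ k ∈ Finset.Icc ((j : ℕ) + 1) (N' + i), ent N H k (j + 1) =
          ∑ k ∈ Finset.Icc ((j : ℕ) + 1) N', ent N H k (j + 1) := by
        symm
        refine Finset.sum_subset (Finset.Icc_subset_Icc_right (by omega)) fun k hk hk' => ?_
        rw [Finset.mem_Icc] at hk hk'
        exact h.lower_left _ _ (by omega) (by omega)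
      have hN' : N' = N' - 1 + 1 := by omega
      have hsum : ∑ k ∈ Finset.Icc ((j : ℕ) + 1) (N' - 1), ent N H k (j + 1) =
          ∑ k ∈ Finset.Icc ((j : ℕ) + 1) (N' - 1), ent N' H₁ k (j + 1) := by
        refine Finset.sum_congr rfl fun k hk => ?_
        rw [Finset.mem_Icc] at hk
        exact h.upper_left _ _ (by omega) (by omega) (by omega) (by omega)
      have htop : ∑ k ∈ Finset.Icc ((j : ℕ) + 1) N', ent N H k (j + 1) =
          ∑ k ∈ Finset.Icc ((j : ℕ) + 1) (N' - 1), ent N H k (j + 1) + ent N H N' (j + 1) := by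
        have := Finset.sum_Icc_succ_top (a := (j : ℕ) + 1) (b := N' - 1) (by omega)
          (fun k => ent N H k (j + 1))
        rwa [← hN'] at this
      have hN0 : (N : ℝ) ≠ 0 := by
        have : N ≠ 0 := by omega
        exact_mod_cast this
      rw [hsplit, htop, hsum, h.middle_row _ (by omega) (by omega)]
      simp only [Pi.one_apply, smul_eq_mul]
      field_simp
      ring
  · rw [submatrix_apply, fromBlocks_apply₂₂, transfer_apply, transfer_apply, glueEquiv_inr,
      glueEquiv_inr]
    have hi := i.2
    have hj := j.2
    have e : Finset.Icc (N' + (j : ℕ) + 1) (N' + i) =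
        (Finset.Icc ((j : ℕ) + 1) i).map (addLeftEmbedding N') := by
      rw [Finset.map_add_left_Icc, add_assoc]
    rw [e, Finset.sum_map]
    refine Finset.sum_congr rfl fun k hk => ?_
    rw [Finset.mem_Icc] at hk
    exact h.lower_right k (j + 1) (by omega) (by omega) (by omega) (by omega)

/-- The Q-functions of a gluing at the node `N'` are observations of the column `glueColumn`
through the second part. -/
theorem IsGluingBlocks.qFun_middle (h : IsGluingBlocks N N' H₁ H₂ H) (h1 : 1 ≤ N') (hle : N' < N)
    (k : ℕ) : qFun N H (k + 1) N' =
      (lastVec (N - N') ᵥ* transfer (N - N') H₂ ^ k) ⬝ᵥ glueColumn N N' H := by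
  have ht := h.transfer_eq h1 hle.le
  have htr : ∀ s t, transfer N H (glueEquiv hle.le s) (glueEquiv hle.le t) =
      fromBlocks (transfer N' H₁) 0
        ((N' / N : ℝ) • vecMulVec 1 (lastVec N' ᵥ* transfer N' H₁) +
          vecMulVec (glueColumn N N' H) (lastVec N')) (transfer (N - N') H₂) s t :=
    fun s t => congrFun (congrFun ht s) t
  have hstep : ∀ m (t : Fin N' ⊕ Fin (N - N')),
      (lastVec N ᵥ* transfer N H ^ (m + 1)) (glueEquiv hle.le t) =
      ∑ i, (lastVec N ᵥ* transfer N H ^ m) (glueEquiv hle.le (Sum.inl i)) *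
        transfer N H (glueEquiv hle.le (Sum.inl i)) (glueEquiv hle.le t) +
      ∑ q, (lastVec N ᵥ* transfer N H ^ m) (glueEquiv hle.le (Sum.inr q)) *
        transfer N H (glueEquiv hle.le (Sum.inr q)) (glueEquiv hle.le t) := by
    intro m t
    rw [pow_succ, ← vecMul_vecMul]
    show ∑ i, (lastVec N ᵥ* transfer N H ^ m) i * transfer N H i _ = _
    rw [← (glueEquiv hle.le).sum_comp, Fintype.sum_sum_type]
  have hsecond : ∀ m (q : Fin (N - N')), (lastVec N ᵥ* transfer N H ^ m)
      (glueEquiv hle.le (Sum.inr q)) = (lastVec (N - N') ᵥ* transfer (N - N') H₂ ^ m) q := by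
    intro m
    induction m with
    | zero =>
      intro q
      rw [pow_zero, pow_zero, vecMul_one, vecMul_one, lastVec, lastVec, glueEquiv_inr]
      congr 1
      rw [eq_iff_iff]
      omega
    | succ m ih =>
      intro q
      rw [hstep]
      simp only [htr, fromBlocks_apply₁₂, fromBlocks_apply₂₂, ih, Matrix.zero_apply, mul_zero,
        Finset.sum_const_zero, zero_add]
      rw [pow_succ, ← vecMul_vecMul]
      rfl
  let l : Fin N' := ⟨N' - 1, by omega⟩
  have hl : ((glueEquiv hle.le (Sum.inl l) : Fin N) : ℕ) + 1 = N' := by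
    show N' - 1 + 1 = N'; omega
  have hl' : (l : ℕ) + 1 = N' := hl
  have hq := qFun_eq_vecMul_transfer_pow N H (k + 1) (by omega) (glueEquiv hle.le (Sum.inl l))
  rw [hl] at hq
  have hA1 : ∀ i, transfer N' H₁ i l = 0 := fun i =>
    transfer_eq_zero _ _ _ _ (by rw [Fin.le_def]; have := i.2; omega)
  rw [hq, hstep]
  simp only [htr, fromBlocks_apply₁₁, fromBlocks_apply₂₁, hsecond, hA1, mul_zero,
    Finset.sum_const_zero, zero_add]
  refine Finset.sum_congr rfl fun q _ => ?_
  have hv : (lastVec N' ᵥ* transfer N' H₁) l = 0 := by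
    show ∑ i, lastVec N' i * transfer N' H₁ i l = 0
    simp [hA1]
  rw [Matrix.add_apply, Matrix.smul_apply, vecMulVec_apply, vecMulVec_apply, hv, lastVec, if_pos hl']
  simp

end Glue

/-! ### Existence and uniqueness of the gluing -/

theorem observed_one_of_mem_optimal' {N : ℕ} (hN : 0 < N) {H : HMatrix N}
    (hH : H ∈ optimalHMatrices.{u} N) (m : ℕ) :
    (lastVec N ᵥ* transfer N H ^ m) ⬝ᵥ 1 = (N.choose (m + 1) : ℝ) / N := by
  by_cases hm : m < N
  · exact observed_one_of_mem_optimal hN hH m hm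
  · rw [pow_eq_zero_of_le (not_lt.1 hm) (transfer_pow_eq_zero N H),
      Nat.choose_eq_zero_of_lt (by omega)]
    simp

theorem observed_last_ne_zero {N : ℕ} (hN : 0 < N) {H : HMatrix N}
    (hH : H ∈ optimalHMatrices.{u} N) :
    (lastVec N ᵥ* transfer N H ^ (N - 1)) ⬝ᵥ 1 ≠ 0 := by
  rw [observed_one_of_mem_optimal' hN hH, Nat.sub_add_cancel hN, Nat.choose_self]
  positivity

/-- The value of `glueColumn` for a gluing: `(N' / N) ((N - N') 1 - A₂ 1)`, where `A₂` is the
transfer matrix of the second part. -/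
noncomputable def optimalColumn (N N' : ℕ) (H₂ : HMatrix (N - N')) : Fin (N - N') → ℝ :=
  (N' / N : ℝ) • (((N : ℝ) - N') • (1 : Fin (N - N') → ℝ) - transfer (N - N') H₂ *ᵥ 1)

theorem choose_identity (p k : ℕ) (hp : 0 < p) :
    (p : ℝ) * (p.choose (k + 1) : ℝ) - (p.choose (k + 2) : ℝ) =
      p * (p + 1) / (k + 2) * ((p - 1).choose k : ℝ) := by
  obtain ⟨p, rfl⟩ := Nat.exists_eq_add_of_le' hp
  have h1 : ((p : ℝ) + 1) * (p.choose k : ℝ) = ((p + 1).choose (k + 1) : ℝ) * (k + 1) := by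
    exact_mod_cast Nat.add_one_mul_choose_eq p k
  have h2 : ((p + 1).choose (k + 2) : ℝ) * (k + 2) =
      ((p + 1).choose (k + 1) : ℝ) * ((p : ℝ) - k) := by
    rcases le_or_gt k p with h | h
    · have := Nat.choose_succ_right_eq (p + 1) (k + 1)
      have e : p + 1 - (k + 1) = p - k := by omega
      rw [e] at this
      have h3 := congrArg (Nat.cast (R := ℝ)) this
      push_cast [Nat.cast_sub h] at h3
      linarith
    · rw [Nat.choose_eq_zero_of_lt (show p + 1 < k + 1 by omega),
        Nat.choose_eq_zero_of_lt (show p + 1 < k + 2 by omega)]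
      simp
  have hk : ((k : ℝ) + 2) ≠ 0 := by positivity
  rw [Nat.add_sub_cancel]
  push_cast
  rw [div_mul_eq_mul_div, eq_div_iff hk]
  linear_combination -h2 + ((p : ℝ) + 1 + 1) * h1.symm

section Glue

variable {N N' : ℕ} {H₁ : HMatrix N'} {H₂ : HMatrix (N - N')} {H : HMatrix N}

/-- The observations of `optimalColumn` are the values that a gluing prescribes for the Q-functions
at the node `N'`. -/
theorem observed_optimalColumn (hle : N' < N)
    (hH₂ : H₂ ∈ optimalHMatrices.{u} (N - N')) (k : ℕ) :
    (lastVec (N - N') ᵥ* transfer (N - N') H₂ ^ k) ⬝ᵥ optimalColumn N N' H₂ =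
      (N' : ℝ) * ((N : ℝ) - N' + 1) / ((N : ℝ) * (((k + 1 : ℕ) : ℝ) + 1)) *
        (Nat.choose (N - N' - 1) k : ℝ) := by
  have hp : 0 < N - N' := by omega
  have hcast : ((N - N' : ℕ) : ℝ) = (N : ℝ) - N' := Nat.cast_sub hle.le
  have hp' : (N : ℝ) - N' ≠ 0 := by
    rw [← hcast]; exact_mod_cast hp.ne'
  have hN : (N : ℝ) ≠ 0 := by
    have : N ≠ 0 := by omega
    exact_mod_cast this
  have h := choose_identity (N - N') k hp
  rw [hcast] at h
  rw [optimalColumn, dotProduct_smul, dotProduct_sub, dotProduct_smul, dotProduct_mulVec,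
    vecMul_vecMul, ← pow_succ, observed_one_of_mem_optimal' hp hH₂,
    observed_one_of_mem_optimal' hp hH₂, hcast, smul_eq_mul, smul_eq_mul]
  have e : (N' / N : ℝ) * (((N : ℝ) - N') * (((N - N').choose (k + 1) : ℝ) / ((N : ℝ) - N'))
      - ((N - N').choose (k + 1 + 1) : ℝ) / ((N : ℝ) - N')) =
      (N' / N : ℝ) / ((N : ℝ) - N') * (((N : ℝ) - N') * ((N - N').choose (k + 1) : ℝ)
        - ((N - N').choose (k + 2) : ℝ)) := by
    field_simp
  rw [e, h]
  have hk : (k : ℝ) + 2 ≠ 0 := by positivity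
  have hk' : (k : ℝ) + 1 + 1 ≠ 0 := by positivity
  push_cast
  field_simp
  ring

/-- The prescribed Q-functions at `N'` determine the column of a gluing, by observability. -/
theorem IsGluing.glueColumn_eq (h : IsGluing N N' H₁ H₂ H) (h1 : 1 ≤ N') (hle : N' < N)
    (hH₂ : H₂ ∈ optimalHMatrices.{u} (N - N')) : glueColumn N N' H = optimalColumn N N' H₂ := by
  have hp : 0 < N - N' := by omega
  rw [← sub_eq_zero]
  refine eq_zero_of_observed_eq_zero (transfer_eq_zero _ H₂) (observed_last_ne_zero hp hH₂) _
    fun m hm => ?_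
  rw [dotProduct_sub, ← h.toBlocks.qFun_middle h1 hle, observed_optimalColumn hle hH₂,
    h.middle_column (m + 1) (by omega) (by omega), Nat.add_sub_cancel, sub_self]

theorem IsGluingBlocks.isGluing (h : IsGluingBlocks N N' H₁ H₂ H) (h1 : 1 ≤ N') (hle : N' < N)
    (hH₂ : H₂ ∈ optimalHMatrices.{u} (N - N')) (hcol : glueColumn N N' H = optimalColumn N N' H₂) :
    IsGluing N N' H₁ H₂ H := by
  refine ⟨h.upper_left, h.upper_right, h.lower_left, h.lower_right, h.middle_row, ?_, ?_⟩
  · have h0 := congrFun hcol ⟨0, by omega⟩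
    have hz : (transfer (N - N') H₂ *ᵥ 1) ⟨0, by omega⟩ = 0 := by
      show ∑ j, transfer (N - N') H₂ ⟨0, by omega⟩ j * (1 : Fin (N - N') → ℝ) j = 0
      refine Finset.sum_eq_zero fun j _ => ?_
      rw [transfer_eq_zero _ _ _ _ (by rw [Fin.le_def]; exact Nat.zero_le _), zero_mul]
    simp only [glueColumn, optimalColumn, Pi.smul_apply, Pi.sub_apply, hz, add_zero,
      Finset.Icc_self, Finset.sum_singleton, Pi.one_apply, smul_eq_mul, mul_one, sub_zero] at h0
    rw [h0]
    ring
  · intro k hk hk'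
    obtain ⟨k, rfl⟩ := Nat.exists_eq_add_of_le' hk
    rw [h.qFun_middle h1 hle, hcol, observed_optimalColumn hle hH₂, Nat.add_sub_cancel]

/-- The entries of the gluing; below the diagonal, the column `N'` consists of multiples of the row
sums of the second part. -/
noncomputable def glueMatrix (N N' : ℕ) (H₁ : HMatrix N') (H₂ : HMatrix (N - N')) : HMatrix N :=
  fun i j =>
    if (i : ℕ) + 1 < N' then
      if (j : ℕ) + 1 < N' then ent N' H₁ (i + 1) (j + 1) else 0
    else if (i : ℕ) + 1 = N' then
      if (j : ℕ) + 1 < N' then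
        -(((N : ℝ) - N') / N) * ∑ k ∈ Finset.Icc ((j : ℕ) + 1) (N' - 1), ent N' H₁ k (j + 1)
      else if (j : ℕ) + 1 = N' then (N' : ℝ) * ((N : ℝ) - N') / N else 0
    else
      if (j : ℕ) + 1 < N' then 0
      else if (j : ℕ) + 1 = N' then
        -(N' / N : ℝ) * ∑ l ∈ Finset.range (i + 1 - N'), ent (N - N') H₂ (i + 1 - N') (l + 1)
      else ent (N - N') H₂ (i + 1 - N') (j + 1 - N')

theorem ent_eq_zero_of_not_mem {N : ℕ} {H : HMatrix N} {k j : ℕ}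
    (h : ¬((1 ≤ k ∧ k ≤ N - 1) ∧ (1 ≤ j ∧ j ≤ N - 1))) : ent N H k j = 0 := dif_neg h

theorem ent_glueMatrix (N N' : ℕ) (H₁ : HMatrix N') (H₂ : HMatrix (N - N')) (k j : ℕ)
    (hk : 1 ≤ k) (hk' : k ≤ N - 1) (hj : 1 ≤ j) (hj' : j ≤ N - 1) :
    ent N (glueMatrix N N' H₁ H₂) k j =
    if k < N' then
      if j < N' then ent N' H₁ k j else 0
    else if k = N' then
      if j < N' then
        -(((N : ℝ) - N') / N) * ∑ k ∈ Finset.Icc j (N' - 1), ent N' H₁ k j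
      else if j = N' then (N' : ℝ) * ((N : ℝ) - N') / N else 0
    else
      if j < N' then 0
      else if j = N' then
        -(N' / N : ℝ) * ∑ l ∈ Finset.range (k - N'), ent (N - N') H₂ (k - N') (l + 1)
      else ent (N - N') H₂ (k - N') (j - N') := by
  obtain ⟨k, rfl⟩ := Nat.exists_eq_add_of_le' hk
  obtain ⟨j, rfl⟩ := Nat.exists_eq_add_of_le' hj
  exact ent_apply N (glueMatrix N N' H₁ H₂) ⟨k, by omega⟩ ⟨j, by omega⟩

theorem glueMatrix_isGluingBlocks (h1 : 1 ≤ N') (hle : N' < N) :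
    IsGluingBlocks N N' H₁ H₂ (glueMatrix N N' H₁ H₂) := by
  constructor
  · intro k j hk hk' hj hj'
    rw [ent_glueMatrix _ _ _ _ _ _ hk (by omega) hj (by omega), if_pos (by omega),
      if_pos (by omega)]
  · intro k j hk hj hkj
    by_cases hr : (1 ≤ k ∧ k ≤ N - 1) ∧ (1 ≤ j ∧ j ≤ N - 1)
    · rw [ent_glueMatrix _ _ _ _ _ _ hr.1.1 hr.1.2 hr.2.1 hr.2.2]
      by_cases hk2 : k < N'
      · rw [if_pos hk2, if_neg (by omega)]
      · rw [if_neg hk2, if_pos (by omega), if_neg (by omega), if_neg (by omega)]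
    · exact ent_eq_zero_of_not_mem hr
  · intro k j hk hj
    by_cases hr : (1 ≤ k ∧ k ≤ N - 1) ∧ (1 ≤ j ∧ j ≤ N - 1)
    · rw [ent_glueMatrix _ _ _ _ _ _ hr.1.1 hr.1.2 hr.2.1 hr.2.2, if_neg (by omega),
        if_neg (by omega), if_pos (by omega)]
    · exact ent_eq_zero_of_not_mem hr
  · intro k j hk hk' hj hj'
    rw [ent_glueMatrix _ _ _ _ _ _ (by omega) (by omega) (by omega) (by omega), if_neg (by omega),
      if_neg (by omega), if_neg (by omega), if_neg (by omega), Nat.add_sub_cancel_left,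
      Nat.add_sub_cancel_left]
  · intro j hj hj'
    rw [ent_glueMatrix _ _ _ _ _ _ (by omega) (by omega) (by omega) (by omega), if_neg (by omega),
      if_pos rfl, if_pos (by omega)]

theorem glueColumn_glueMatrix (h1 : 1 ≤ N') (hle : N' < N) :
    glueColumn N N' (glueMatrix N N' H₁ H₂) = optimalColumn N N' H₂ := by
  ext q
  have hq := q.2
  have hN : (N : ℝ) ≠ 0 := by
    have : N ≠ 0 := by omega
    exact_mod_cast this
  have hcol : ∀ i ∈ Finset.Icc 1 (q : ℕ), ent N (glueMatrix N N' H₁ H₂) (N' + i) N' =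
      -(N' / N : ℝ) * ∑ l ∈ Finset.range i, ent (N - N') H₂ i (l + 1) := by
    intro i hi
    rw [Finset.mem_Icc] at hi
    rw [ent_glueMatrix _ _ _ _ _ _ (by omega) (by omega) (by omega) (by omega), if_neg (by omega),
      if_neg (by omega), if_neg (by omega), if_pos rfl, Nat.add_sub_cancel_left]
  have hdiag : ent N (glueMatrix N N' H₁ H₂) N' N' = (N' : ℝ) * ((N : ℝ) - N') / N := by
    rw [ent_glueMatrix _ _ _ _ _ _ (by omega) (by omega) (by omega) (by omega), if_neg (by omega),
      if_pos rfl, if_neg (by omega), if_pos rfl]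
  have hleft : glueColumn N N' (glueMatrix N N' H₁ H₂) q = (N' : ℝ) * ((N : ℝ) - N') / N +
      -(N' / N : ℝ) * ∑ i ∈ Finset.Icc 1 (q : ℕ),
        ∑ l ∈ Finset.range i, ent (N - N') H₂ i (l + 1) := by
    have e : Finset.Icc N' (N' + q) =
        insert N' ((Finset.Icc 1 (q : ℕ)).map (addLeftEmbedding N')) := by
      rw [Finset.map_add_left_Icc]
      ext i
      simp only [Finset.mem_Icc, Finset.mem_insert]
      omega
    rw [glueColumn, e, Finset.sum_insert (by simp), Finset.sum_map, hdiag, Finset.mul_sum]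
    congr 1
    exact Finset.sum_congr rfl hcol
  have hright : (transfer (N - N') H₂ *ᵥ 1) q = ∑ i ∈ Finset.Icc 1 (q : ℕ),
        ∑ l ∈ Finset.range i, ent (N - N') H₂ i (l + 1) := by
    show ∑ j, transfer (N - N') H₂ q j * 1 = _
    simp only [mul_one, transfer_apply]
    rw [Fin.sum_univ_eq_sum_range
      (fun j : ℕ => ∑ i ∈ Finset.Icc (j + 1) (q : ℕ), ent (N - N') H₂ i (j + 1)) (N - N')]
    refine Finset.sum_comm' fun j i => ?_
    simp only [Finset.mem_range, Finset.mem_Icc]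
    omega
  rw [hleft, optimalColumn, Pi.smul_apply, Pi.sub_apply, hright]
  simp only [Pi.smul_apply, Pi.one_apply, smul_eq_mul]
  ring

theorem isGluing_glueMatrix (h1 : 1 ≤ N') (hle : N' < N)
    (hH₂ : H₂ ∈ optimalHMatrices.{u} (N - N')) :
    IsGluing N N' H₁ H₂ (glueMatrix N N' H₁ H₂) :=
  (glueMatrix_isGluingBlocks h1 hle).isGluing h1 hle hH₂ (glueColumn_glueMatrix h1 hle)

theorem IsGluing.unique {H' : HMatrix N} (h : IsGluing N N' H₁ H₂ H)
    (h' : IsGluing N N' H₁ H₂ H') (h1 : 1 ≤ N') (hle : N' < N)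
    (hH₁ : _root_.IsLowerTriangular H₁) (hH₂ : H₂ ∈ optimalHMatrices.{u} (N - N')) : H = H' := by
  refine transfer_injective (h.toBlocks.lowerTriangular hH₁ hH₂.1)
    (h'.toBlocks.lowerTriangular hH₁ hH₂.1) ?_
  have e : (transfer N H).submatrix (glueEquiv hle.le) (glueEquiv hle.le) =
      (transfer N H').submatrix (glueEquiv hle.le) (glueEquiv hle.le) := by
    rw [h.toBlocks.transfer_eq h1, h'.toBlocks.transfer_eq h1, h.glueColumn_eq h1 hle hH₂,
      h'.glueColumn_eq h1 hle hH₂]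
  exact (Matrix.reindex (glueEquiv hle.le).symm (glueEquiv hle.le).symm).injective e

/-! ### The certificates of a gluing -/

theorem lastVec_comp_glueEquiv (hle : N' < N) :
    lastVec N ∘ glueEquiv hle.le = Sum.elim (fun _ => (0 : ℝ)) (lastVec (N - N')) := by
  ext s
  rcases s with i | i
  · have := i.2
    simp only [Function.comp_apply, lastVec, glueEquiv_inl, Sum.elim_inl]
    exact if_neg (by omega)
  · simp only [Function.comp_apply, lastVec, glueEquiv_inr, Sum.elim_inr]
    congr 1
    rw [eq_iff_iff]
    omega

/-- The solution of the Lyapunov equation of a gluing. -/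
theorem IsGluing.lyap_eq (h : IsGluing N N' H₁ H₂ H) (h1 : 1 ≤ N') (hle : N' < N)
    (hH₂ : H₂ ∈ optimalHMatrices.{u} (N - N')) :
    (lyap (transfer N H) (lastVec N) N).submatrix (glueEquiv hle.le) (glueEquiv hle.le) =
      fromBlocks ((N' / N : ℝ) ^ 2 • (lyap (transfer N' H₁) (lastVec N') N' +
          (1 / ((N : ℝ) - N')) • vecMulVec (lastVec N') (lastVec N')))
        (-((N' / N : ℝ) / ((N : ℝ) - N')) • vecMulVec (lastVec N') (lastVec (N - N')))
        (-((N' / N : ℝ) / ((N : ℝ) - N')) • vecMulVec (lastVec (N - N')) (lastVec N'))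
        (lyap (transfer (N - N') H₂) (lastVec (N - N')) (N - N')) := by
  have hp : 0 < N - N' := by omega
  have hcast : ((N - N' : ℕ) : ℝ) = (N : ℝ) - N' := Nat.cast_sub hle.le
  have hp' : (N : ℝ) - N' ≠ 0 := by
    rw [← hcast]; exact_mod_cast hp.ne'
  have hA := h.toBlocks.transfer_eq h1 hle.le
  set ε := glueEquiv hle.le with hε
  have hnil : IsNilpotent ((transfer N H).submatrix ε ε) := by
    refine ⟨N, ?_⟩
    have e : ∀ m, (transfer N H).submatrix ε ε ^ m = (transfer N H ^ m).submatrix ε ε := by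
      intro m
      induction m with
      | zero => rw [pow_zero, pow_zero, submatrix_one_equiv]
      | succ m ih => rw [pow_succ, ih, submatrix_mul_equiv, pow_succ]
    rw [e, transfer_pow_eq_zero]
    rfl
  refine lyapunov_unique _ hnil (E := fromBlocks 0 0 0
    (vecMulVec (lastVec (N - N')) (lastVec (N - N')))) ?_ ?_
  · have := congrArg (fun M => M.submatrix ε ε)
      (lyap_equation _ (lastVec N) N (by omega) (transfer_pow_eq_zero N H))
    rw [transpose_submatrix, submatrix_mul_equiv, submatrix_mul_equiv]
    refine Eq.trans this ?_
    have hv := lastVec_comp_glueEquiv hle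
    have hv' : ∀ s, lastVec N (ε s) = Sum.elim (fun _ => (0 : ℝ)) (lastVec (N - N')) s := fun s => congrFun hv s
    ext s t
    rw [submatrix_apply, vecMulVec_apply, hv', hv']
    rcases s with s | s <;> rcases t with t | t <;> simp [vecMulVec_apply]
  · rw [hA]
    have heA := observed_one_of_mem_optimal' hp hH₂ 1
    have he := observed_one_of_mem_optimal' hp hH₂ 0
    rw [pow_one, ← dotProduct_mulVec, hcast, Nat.cast_choose_two, hcast] at heA
    rw [pow_zero, vecMul_one, Nat.choose_one_right, div_self (by exact_mod_cast hp.ne')] at he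
    have hrow := (isCertified_of_mem_optimal hp hH₂).rowSum
    rw [hcast] at hrow
    exact lyapunov_fromBlocks _ _ _ _ _ _ (N' / N : ℝ) ((N : ℝ) - N') hp'
      (lyap_equation _ _ _ h1 (transfer_pow_eq_zero _ _))
      (lyap_equation _ _ _ hp (transfer_pow_eq_zero _ _)) (lyap_transpose _ _ _)
      hrow he (by rw [heA]; field_simp) _ (h.glueColumn_eq h1 hle hH₂)

end Glue

section Glue

variable {N N' : ℕ} {H₁ : HMatrix N'} {H₂ : HMatrix (N - N')} {H : HMatrix N}

theorem sum_lastVec {N : ℕ} (hN : 0 < N) : ∑ i, lastVec N i = 1 := by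
  have := sum_lastVec_mul (⟨N - 1, by omega⟩ : Fin N) (by show N - 1 + 1 = N; omega) 1
  simpa using this

theorem IsGluing.isCertified (h : IsGluing N N' H₁ H₂ H) (h1 : 1 ≤ N') (hle : N' < N)
    (hH₁ : H₁ ∈ optimalHMatrices.{u} N') (hH₂ : H₂ ∈ optimalHMatrices.{u} (N - N')) :
    IsCertified N H := by
  have hp : 0 < N - N' := by omega
  have hcast : ((N - N' : ℕ) : ℝ) = (N : ℝ) - N' := Nat.cast_sub hle.le
  have hp' : (0 : ℝ) < (N : ℝ) - N' := by
    rw [← hcast]; exact_mod_cast hp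
  have hn : (0 : ℝ) < N' := by exact_mod_cast h1
  have hN : (0 : ℝ) < N := by linarith
  have hc₁ := isCertified_of_mem_optimal h1 hH₁
  have hc₂ := isCertified_of_mem_optimal hp hH₂
  have hF := h.lyap_eq h1 hle hH₂
  have hF' := fun s t => congrFun (congrFun hF s) t
  simp only [submatrix_apply] at hF'
  refine ⟨h.toBlocks.lowerTriangular hH₁.1 hH₂.1, ?_, ?_⟩
  · ext a
    obtain ⟨s, rfl⟩ := (glueEquiv hle.le).surjective a
    have hlast := congrFun (lastVec_comp_glueEquiv hle) s
    rw [Function.comp_apply] at hlast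
    rw [Pi.smul_apply, hlast]
    show ∑ b, lyap (transfer N H) (lastVec N) N (glueEquiv hle.le s) b * 1 = _
    simp only [mul_one]
    rw [← (glueEquiv hle.le).sum_comp, Fintype.sum_sum_type]
    simp only [hF']
    rcases s with i | i
    · have hrow := congrFun hc₁.rowSum i
      simp only [mulVec, dotProduct, Pi.one_apply, mul_one, Pi.smul_apply, smul_eq_mul] at hrow
      simp only [fromBlocks_apply₁₁, fromBlocks_apply₁₂, Matrix.smul_apply, Matrix.add_apply,
        vecMulVec_apply, smul_eq_mul, ← Finset.mul_sum, Finset.sum_add_distrib, hrow,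
        sum_lastVec h1, sum_lastVec hp, Sum.elim_inl]
      field_simp
      ring
    · have hrow := congrFun hc₂.rowSum i
      simp only [mulVec, dotProduct, Pi.one_apply, mul_one, Pi.smul_apply, smul_eq_mul] at hrow
      simp only [fromBlocks_apply₂₁, fromBlocks_apply₂₂, Matrix.smul_apply,
        vecMulVec_apply, smul_eq_mul, ← Finset.mul_sum, hrow,
        sum_lastVec h1, Sum.elim_inr, hcast]
      field_simp
      ring
  · intro a c hca
    obtain ⟨s, rfl⟩ := (glueEquiv hle.le).surjective a
    obtain ⟨t, rfl⟩ := (glueEquiv hle.le).surjective c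
    rw [Fin.lt_def] at hca
    rw [hF']
    have hnn : ∀ {M : ℕ} (i : Fin M), 0 ≤ lastVec M i := fun i => by
      unfold lastVec; split_ifs <;> norm_num
    rcases s with i | i <;> rcases t with j | j
    · simp only [glueEquiv_inl] at hca
      have hj : lastVec N' j = 0 := if_neg (by have := i.2; omega)
      rw [fromBlocks_apply₁₁, Matrix.smul_apply, Matrix.add_apply, Matrix.smul_apply,
        vecMulVec_apply, hj, mul_zero, smul_zero, add_zero, smul_eq_mul]
      exact mul_nonpos_of_nonneg_of_nonpos (by positivity) (hc₁.nonpos i j hca)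
    · simp only [glueEquiv_inl, glueEquiv_inr] at hca
      have := i.2
      omega
    · rw [fromBlocks_apply₂₁, Matrix.smul_apply, vecMulVec_apply, smul_eq_mul]
      exact mul_nonpos_of_nonpos_of_nonneg (neg_nonpos.2 (by positivity))
        (mul_nonneg (hnn _) (hnn _))
    · simp only [glueEquiv_inr] at hca
      exact hc₂.nonpos i j (by rw [Fin.lt_def]; omega)

theorem IsGluing.cert_eq (h : IsGluing N N' H₁ H₂ H) (h1 : 1 ≤ N') (hle : N' < N)
    (hH₂ : H₂ ∈ optimalHMatrices.{u} (N - N')) (k j : ℕ) (hj : 1 ≤ j) (hjk : j < k) (hk : k ≤ N) :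
    cert N H k j = glueCert N N' (cert N' H₁) (cert (N - N') H₂) k j := by
  have hp : 0 < N - N' := by omega
  have hcast : ((N - N' : ℕ) : ℝ) = (N : ℝ) - N' := Nat.cast_sub hle.le
  have hp' : (0 : ℝ) < (N : ℝ) - N' := by
    rw [← hcast]; exact_mod_cast hp
  have hn : (0 : ℝ) < N' := by exact_mod_cast h1
  have hN : (0 : ℝ) < N := by linarith
  have hF := h.lyap_eq h1 hle hH₂
  have hF' := fun s t => congrFun (congrFun hF s) t
  simp only [submatrix_apply] at hF'
  unfold glueCert
  split_ifs with hk1 hj1 hkj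
  · let a : Fin N' := ⟨k - 1, by omega⟩
    let c : Fin N' := ⟨j - 1, by omega⟩
    have ha : (a : ℕ) + 1 = k := by show k - 1 + 1 = k; omega
    have hc : (c : ℕ) + 1 = j := by show j - 1 + 1 = j; omega
    have hca : c < a := by rw [Fin.lt_def]; omega
    have e1 := cert_eq_lyap N H (glueEquiv hle.le (Sum.inl a)) (glueEquiv hle.le (Sum.inl c)) hca
    have e2 := cert_eq_lyap N' H₁ a c hca
    rw [glueEquiv_inl, glueEquiv_inl, ha, hc, hF', fromBlocks_apply₁₁, Matrix.smul_apply,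
      Matrix.add_apply, Matrix.smul_apply, vecMulVec_apply] at e1
    have hz : lastVec N' c = 0 := if_neg (by omega)
    rw [ha, hc] at e2
    rw [e1, e2, hz, mul_zero, smul_zero, add_zero, smul_eq_mul]
    field_simp
  · let a : Fin (N - N') := ⟨k - N' - 1, by omega⟩
    let c : Fin (N - N') := ⟨j - N' - 1, by omega⟩
    have ha : (a : ℕ) + 1 = k - N' := by show k - N' - 1 + 1 = k - N'; omega
    have hc : (c : ℕ) + 1 = j - N' := by show j - N' - 1 + 1 = j - N'; omega
    have hca : c < a := by rw [Fin.lt_def]; omega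
    have e1 := cert_eq_lyap N H (glueEquiv hle.le (Sum.inr a)) (glueEquiv hle.le (Sum.inr c))
      (by rw [Fin.lt_def, glueEquiv_inr, glueEquiv_inr]; omega)
    have e2 := cert_eq_lyap (N - N') H₂ a c hca
    rw [glueEquiv_inr, glueEquiv_inr, add_assoc, add_assoc, ha, hc, hF', fromBlocks_apply₂₂,
      Nat.add_sub_cancel' (by omega), Nat.add_sub_cancel' (by omega)] at e1
    rw [ha, hc, hcast] at e2
    rw [e1, e2]
    field_simp
  all_goals
    let a : Fin (N - N') := ⟨k - N' - 1, by omega⟩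
    let c : Fin N' := ⟨j - 1, by omega⟩
    have ha : N' + (a : ℕ) + 1 = k := by show N' + (k - N' - 1) + 1 = k; omega
    have hc : (c : ℕ) + 1 = j := by show j - 1 + 1 = j; omega
    have e1 := cert_eq_lyap N H (glueEquiv hle.le (Sum.inr a)) (glueEquiv hle.le (Sum.inl c))
      (by rw [Fin.lt_def, glueEquiv_inr, glueEquiv_inl]; omega)
    rw [glueEquiv_inl, glueEquiv_inr, ha, hc, hF', fromBlocks_apply₂₁, Matrix.smul_apply,
      vecMulVec_apply, smul_eq_mul] at e1
    rw [e1]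
  · have hza : lastVec (N - N') a = 1 := if_pos (by omega)
    have hzc : lastVec N' c = 1 := if_pos (by omega)
    rw [hza, hzc]
    field_simp
  · have hz : lastVec (N - N') a * lastVec N' c = 0 := by
      by_cases hkN : k = N
      · have hzc : lastVec N' c = 0 := if_neg (fun h => hkj ⟨hkN, by omega⟩)
        rw [hzc, mul_zero]
      · have hza : lastVec (N - N') a = 0 := if_neg (by omega)
        rw [hza, zero_mul]
    rw [hz, mul_zero, mul_zero]

end Glue

/-! ### Vertices -/

/-- The solution of the Lyapunov equation of an optimal matrix is nonsingular: its kernel is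
invariant under the transfer matrix and invisible from the last coordinate. -/
theorem eq_zero_of_lyap_mulVec_eq_zero {N : ℕ} (hN : 0 < N) {H : HMatrix N}
    (hH : H ∈ optimalHMatrices.{u} N) (v : Fin N → ℝ)
    (hv : lyap (transfer N H) (lastVec N) N *ᵥ v = 0) : v = 0 := by
  have hFt := lyap_transpose (transfer N H) (lastVec N) N
  have hF := lyap_equation _ (lastVec N) N hN (transfer_pow_eq_zero N H)
  refine eq_zero_of_observed_eq_zero (transfer_eq_zero N H) (observed_last_ne_zero hN hH) v
    fun m _ => ?_
  generalize lyap (transfer N H) (lastVec N) N = F at hv hFt hF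
  generalize transfer N H = A at hF ⊢
  have step : ∀ w : Fin N → ℝ, F *ᵥ w = 0 → lastVec N ⬝ᵥ w = 0 ∧ F *ᵥ (A *ᵥ w) = 0 := by
    intro w hw
    have h1 := congrArg (fun M => M *ᵥ w) hF
    simp only [add_mulVec, ← mulVec_mulVec, hw, mulVec_zero, zero_add] at h1
    have h2 : vecMulVec (lastVec N) (lastVec N) *ᵥ w = (lastVec N ⬝ᵥ w) • lastVec N := by
      ext i
      simp only [mulVec, dotProduct, vecMulVec_apply, Pi.smul_apply, smul_eq_mul, Finset.sum_mul]
      exact Finset.sum_congr rfl fun j _ => by ring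
    rw [h2] at h1
    have h3 : w ⬝ᵥ (F *ᵥ (A *ᵥ w)) = 0 := by
      rw [dotProduct_mulVec, ← mulVec_transpose, hFt, hw, zero_dotProduct]
    rw [h1, dotProduct_smul, dotProduct_comm w, smul_eq_mul, mul_self_eq_zero] at h3
    exact ⟨h3, by rw [h1, h3, zero_smul]⟩
  have hker : ∀ m, F *ᵥ (A ^ m *ᵥ v) = 0 := by
    intro m
    induction m with
    | zero => rwa [pow_zero, one_mulVec]
    | succ m ih => rw [pow_succ', ← mulVec_mulVec]; exact (step _ ih).2
  rw [← dotProduct_mulVec]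
  exact (step _ (hker m)).1

/-- Every node but the last has an edge to a larger node. Otherwise the Lyapunov equation makes
the diagonal entry at this node vanish, and with it, by the zero row sum and the signs of the
certificates, the whole row; this contradicts nonsingularity. -/
theorem exists_cert_ne_zero {N : ℕ} {H : HMatrix N} (hH : H ∈ optimalHMatrices.{u} N) (j : ℕ)
    (hj : 1 ≤ j) (hjN : j < N) : ∃ k, j < k ∧ k ≤ N ∧ cert N H k j ≠ 0 := by
  have hN : 0 < N := by omega
  by_contra! hcon
  let c : Fin N := ⟨j - 1, by omega⟩
  have hc : (c : ℕ) + 1 = j := by show j - 1 + 1 = j; omega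
  have hcert := isCertified_of_mem_optimal hN hH
  have hker := eq_zero_of_lyap_mulVec_eq_zero hN hH (Pi.single c 1)
  have hFt := lyap_transpose (transfer N H) (lastVec N) N
  have hF := lyap_equation _ (lastVec N) N hN (transfer_pow_eq_zero N H)
  have hrow := hcert.rowSum
  have hnp := hcert.nonpos
  have hbelow : ∀ k : Fin N, c < k → lyap (transfer N H) (lastVec N) N k c = 0 := by
    intro k hk
    have h := cert_eq_lyap N H k c hk
    rw [hc, hcon (k + 1) (by rw [Fin.lt_def] at hk; omega) (by omega)] at h
    have hN' : -(N : ℝ) ≠ 0 := neg_ne_zero.2 (by exact_mod_cast hN.ne')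
    exact (mul_eq_zero.1 h.symm).resolve_left hN'
  have hA := transfer_eq_zero N H
  generalize lyap (transfer N H) (lastVec N) N = F at hker hFt hF hrow hnp hbelow
  generalize transfer N H = A at hF hA
  have hsym : ∀ k l, F l k = F k l := fun k l => congrFun (congrFun hFt k) l
  have hprod : ∀ k, F k c * A k c = 0 := by
    intro k
    by_cases hk : k ≤ c
    · rw [hA k c hk, mul_zero]
    · rw [hbelow k (not_le.1 hk), zero_mul]
  have hdiag : F c c = 0 := by
    have h := congrFun (congrFun hF c) c
    have hz : lastVec N c = 0 := if_neg (by omega)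
    have h1 : (Aᵀ * F) c c = 0 := by
      rw [mul_apply]
      exact Finset.sum_eq_zero fun k _ => by rw [transpose_apply, mul_comm, hprod]
    have h2 : (F * A) c c = 0 := by
      rw [mul_apply]
      exact Finset.sum_eq_zero fun k _ => by rw [hsym k c, hprod]
    rwa [Matrix.add_apply, Matrix.add_apply, h1, h2, add_zero, add_zero, vecMulVec_apply, hz,
      mul_zero] at h
  have hle : ∀ k ∈ Finset.univ, F c k ≤ 0 := by
    intro k _
    rcases lt_trichotomy k c with hk | hk | hk
    · exact hnp c k hk
    · rw [hk, hdiag]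
    · rw [hsym k c, hbelow k hk]
  have hsum : ∑ k, F c k = 0 := by
    have h := congrFun hrow c
    have hz : lastVec N c = 0 := if_neg (by omega)
    simpa [mulVec, dotProduct, hz] using h
  have hall := (Finset.sum_eq_zero_iff_of_nonpos hle).1 hsum
  have : Pi.single c (1 : ℝ) = (0 : Fin N → ℝ) := hker (by
    ext k
    rw [mulVec_single_one, Matrix.col_apply, hsym c k, hall k (Finset.mem_univ k)]
    rfl)
  exact one_ne_zero (Pi.single_eq_zero_iff.1 this)

theorem mem_certSupport {N : ℕ} {H : HMatrix N} {p : ℕ × ℕ} :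
    p ∈ certSupport N H ↔ 1 ≤ p.2 ∧ p.2 < p.1 ∧ p.1 ≤ N ∧ cert N H p.1 p.2 ≠ 0 := by
  unfold certSupport
  rw [Finset.mem_filter, Finset.mem_product, Finset.mem_Icc, Finset.mem_Icc]
  constructor
  · rintro ⟨⟨⟨h1, h2⟩, h3, h4⟩, h5, h6⟩
    exact ⟨h3, h5, h2, h6⟩
  · rintro ⟨h1, h2, h3, h4⟩
    exact ⟨⟨⟨by omega, h3⟩, h1, by omega⟩, h2, h4⟩

theorem Icc_subset_image_certSupport {N : ℕ} {H : HMatrix N} (hH : H ∈ optimalHMatrices.{u} N) :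
    Finset.Icc 1 (N - 1) ⊆ (certSupport N H).image Prod.snd := by
  intro j hj
  rw [Finset.mem_Icc] at hj
  obtain ⟨k, h1, h2, h3⟩ := exists_cert_ne_zero hH j hj.1 (by omega)
  exact Finset.mem_image.2 ⟨(k, j), mem_certSupport.2 ⟨hj.1, h1, h2, h3⟩, rfl⟩

/-- An optimal matrix has at least one nonzero certificate for each node but the last. -/
theorem le_card_certSupport {N : ℕ} {H : HMatrix N} (hH : H ∈ optimalHMatrices.{u} N) :
    N - 1 ≤ (certSupport N H).card := by
  have := (Finset.card_le_card (Icc_subset_image_certSupport hH)).trans Finset.card_image_le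
  rwa [Nat.card_Icc, Nat.add_sub_cancel] at this

theorem IsGluing.card_certSupport_le {N N' : ℕ} {H₁ : HMatrix N'} {H₂ : HMatrix (N - N')}
    {H : HMatrix N} (h : IsGluing N N' H₁ H₂ H) (h1 : 1 ≤ N') (hle : N' < N)
    (hH₂ : H₂ ∈ optimalHMatrices.{u} (N - N')) :
    (certSupport N H).card ≤ (certSupport N' H₁).card + (certSupport (N - N') H₂).card + 1 := by
  have hsub : certSupport N H ⊆ (certSupport N' H₁ ∪
      (certSupport (N - N') H₂).image (fun p => (p.1 + N', p.2 + N'))) ∪ {(N, N')} := by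
    rintro ⟨k, j⟩ hp
    obtain ⟨hj, hjk, hk, hne⟩ := mem_certSupport.1 hp
    simp only at hj hjk hk hne
    rw [h.cert_eq h1 hle hH₂ k j hj hjk hk] at hne
    unfold glueCert at hne
    rw [Finset.mem_union, Finset.mem_union, Finset.mem_singleton]
    split_ifs at hne with hk1 hj1 hkj
    · exact Or.inl (Or.inl (mem_certSupport.2 ⟨hj, hjk, hk1, right_ne_zero_of_mul hne⟩))
    · refine Or.inl (Or.inr (Finset.mem_image.2 ⟨(k - N', j - N'), mem_certSupport.2
        ⟨by show 1 ≤ j - N'; omega, by show j - N' < k - N'; omega,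
          by show k - N' ≤ N - N'; omega, right_ne_zero_of_mul hne⟩, ?_⟩))
      simp only [Prod.mk.injEq]
      omega
    · exact Or.inr (by rw [hkj.1, hkj.2])
    · exact absurd rfl hne
  refine (Finset.card_le_card hsub).trans ((Finset.card_union_le _ _).trans ?_)
  rw [Finset.card_singleton]
  exact Nat.add_le_add_right ((Finset.card_union_le _ _).trans
    (Nat.add_le_add_left Finset.card_image_le _)) 1

theorem mem_optimal_one (H : HMatrix 1) : H ∈ optimalHMatrices.{u} 1 := by
  refine IsCertified.mem_optimal le_rfl ⟨fun i => i.elim0, ?_, fun k j hjk => ?_⟩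
  · refine lyap_mulVec_one _ _ 1 one_pos fun m hm => ?_
    obtain rfl : m = 0 := by omega
    simp [dotProduct, lastVec]
  · exact absurd hjk (by rw [Subsingleton.elim j k]; exact lt_irrefl k)

theorem certSupport_one (H : HMatrix 1) : certSupport 1 H = ∅ := by
  rw [Finset.eq_empty_iff_forall_notMem]
  intro p hp
  have := mem_certSupport.1 hp
  omega

/-- Gluing single nodes yields an optimal matrix with only `N - 1` nonzero H-certificates. -/
theorem exists_card_certSupport_le (N : ℕ) (hN : 1 ≤ N) :
    ∃ H ∈ optimalHMatrices.{u} N, (certSupport N H).card ≤ N - 1 := by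
  induction N, hN using Nat.le_induction with
  | base =>
    refine ⟨0, mem_optimal_one 0, ?_⟩
    rw [certSupport_one, Finset.card_empty]
  | succ N hN ih =>
    obtain ⟨H₂, hH₂, hcard⟩ := ih
    have hg : IsGluing (N + 1) 1 (0 : HMatrix 1) H₂ (glueMatrix (N + 1) 1 0 H₂) :=
      isGluing_glueMatrix (N := N + 1) (N' := 1) le_rfl (by omega) hH₂
    refine ⟨_, (hg.isCertified le_rfl (by omega) (mem_optimal_one 0) hH₂).mem_optimal (by omega), ?_⟩
    have h := hg.card_certSupport_le le_rfl (by omega) hH₂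
    rw [certSupport_one, Finset.card_empty] at h
    have h2 : (certSupport (N + 1 - 1) H₂).card ≤ N - 1 := hcard
    omega

/-- The vertices are the optimal matrices with the least conceivable number `N - 1` of nonzero
certificates. -/
theorem isVertex_iff {N : ℕ} (hN : 1 ≤ N) {H : HMatrix N} :
    IsVertex.{u} N H ↔ H ∈ optimalHMatrices.{u} N ∧ (certSupport N H).card ≤ N - 1 := by
  constructor
  · rintro ⟨h, hmin⟩
    obtain ⟨H', hH', hcard⟩ := exists_card_certSupport_le.{u} N hN
    exact ⟨h, (hmin H' hH').trans hcard⟩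
  · rintro ⟨h, hcard⟩
    exact ⟨h, fun H' hH' => hcard.trans (le_card_certSupport hH')⟩

theorem diagram_adj_of_lt {N : ℕ} {H : HMatrix N} {j k : Fin N} (hjk : j < k) :
    (diagram N H).Adj j k ↔ cert N H ((k : ℕ) + 1) ((j : ℕ) + 1) ≠ 0 := by
  rw [diagram, SimpleGraph.fromRel_adj]
  constructor
  · rintro ⟨-, h | h⟩
    · exact h.2
    · exact absurd hjk h.1.not_gt
  · exact fun h => ⟨hjk.ne, Or.inl ⟨hjk, h⟩⟩

theorem IsVertex.isArcDiagram {N : ℕ} {H : HMatrix N} (hN : 1 ≤ N) (h : IsVertex.{u} N H) :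
    IsArcDiagram (diagram N H) := by
  obtain ⟨hH, hcard⟩ := (isVertex_iff hN).1 h
  have hinj : Set.InjOn Prod.snd (certSupport N H : Set (ℕ × ℕ)) := by
    rw [← Finset.card_image_iff]
    refine le_antisymm Finset.card_image_le (hcard.trans ?_)
    have := Finset.card_le_card (Icc_subset_image_certSupport hH)
    rwa [Nat.card_Icc, Nat.add_sub_cancel] at this
  intro j hj
  obtain ⟨k, hk1, hk2, hk3⟩ := exists_cert_ne_zero hH (j + 1) (by omega) hj
  refine ⟨⟨k - 1, by omega⟩, ⟨?_, ?_⟩, ?_⟩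
  · rw [Fin.lt_def]; show (j : ℕ) < k - 1; omega
  · rw [diagram_adj_of_lt (by rw [Fin.lt_def]; show (j : ℕ) < k - 1; omega)]
    show cert N H (k - 1 + 1) _ ≠ 0
    rwa [Nat.sub_add_cancel (by omega)]
  · rintro l ⟨hjl, hadj⟩
    rw [diagram_adj_of_lt hjl] at hadj
    rw [Fin.lt_def] at hjl
    have hmem : ((l : ℕ) + 1, (j : ℕ) + 1) ∈ certSupport N H :=
      mem_certSupport.2 ⟨by show 1 ≤ (j : ℕ) + 1; omega, by show (j : ℕ) + 1 < l + 1; omega,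
        l.2, hadj⟩
    have hmem' : (k, (j : ℕ) + 1) ∈ certSupport N H :=
      mem_certSupport.2 ⟨by show 1 ≤ (j : ℕ) + 1; omega, hk1, hk2, hk3⟩
    have := congrArg Prod.fst (hinj hmem hmem' rfl)
    simp only at this
    exact Fin.ext (by show (l : ℕ) = k - 1; omega)

theorem IsGluing.diagram_eq {N N' : ℕ} {H₁ : HMatrix N'} {H₂ : HMatrix (N - N')}
    {H : HMatrix N} (h : IsGluing N N' H₁ H₂ H) (h1 : 1 ≤ N') (hle : N' < N)
    (hH₂ : H₂ ∈ optimalHMatrices.{u} (N - N')) :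
    diagram N H = glueDiagram N N' (diagram N' H₁) (diagram (N - N') H₂) := by
  have hcast : ((N - N' : ℕ) : ℝ) = (N : ℝ) - N' := Nat.cast_sub hle.le
  have hp' : (0 : ℝ) < (N : ℝ) - N' := by
    rw [← hcast]
    have : 0 < N - N' := by omega
    exact_mod_cast this
  have hn : (0 : ℝ) < N' := by exact_mod_cast h1
  have hN : (0 : ℝ) < N := by linarith
  have key : ∀ a b : Fin N, a < b → ((diagram N H).Adj a b ↔
      (glueDiagram N N' (diagram N' H₁) (diagram (N - N') H₂)).Adj a b) := by
    intro a b hab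
    rw [diagram_adj_of_lt hab, h.cert_eq h1 hle hH₂ _ _ (by omega)
      (by rw [Fin.lt_def] at hab; omega)
      (show (b : ℕ) + 1 ≤ N from b.2)]
    have hne : a ≠ b := hab.ne
    rw [Fin.lt_def] at hab
    rw [glueDiagram, SimpleGraph.fromRel_adj]
    unfold glueCert
    constructor
    · intro hc
      refine ⟨hne, Or.inl ?_⟩
      split_ifs at hc with hb ha hab'
      · refine Or.inl ⟨⟨a, by omega⟩, ⟨b, by omega⟩, ?_, rfl, rfl⟩
        exact (diagram_adj_of_lt (by rw [Fin.lt_def]; exact hab)).2 (right_ne_zero_of_mul hc)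
      · refine Or.inr (Or.inl ⟨⟨a - N', by omega⟩, ⟨b - N', by omega⟩, ?_,
          by show (a : ℕ) = N' + (a - N'); omega, by show (b : ℕ) = N' + (b - N'); omega⟩)
        rw [diagram_adj_of_lt (by rw [Fin.lt_def]; show (a : ℕ) - N' < b - N'; omega)]
        have e1 : (b : ℕ) + 1 - N' = b - N' + 1 := by omega
        have e2 : (a : ℕ) + 1 - N' = a - N' + 1 := by omega
        rw [e1, e2] at hc
        exact right_ne_zero_of_mul hc
      · exact Or.inr (Or.inr ⟨hab'.2, hab'.1⟩)
      · exact absurd rfl hc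
    · rintro ⟨-, hr⟩
      have hr' : (∃ c d : Fin N', (diagram N' H₁).Adj c d ∧ (a : ℕ) = c ∧ (b : ℕ) = d) ∨
          (∃ c d : Fin (N - N'), (diagram (N - N') H₂).Adj c d ∧ (a : ℕ) = N' + c ∧
            (b : ℕ) = N' + d) ∨ ((a : ℕ) + 1 = N' ∧ (b : ℕ) + 1 = N) := by
        rcases hr with hr | ⟨c, d, hcd, e1, e2⟩ | ⟨c, d, hcd, e1, e2⟩ | ⟨e1, e2⟩
        · exact hr
        · exact Or.inl ⟨d, c, hcd.symm, e2, e1⟩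
        · exact Or.inr (Or.inl ⟨d, c, hcd.symm, e2, e1⟩)
        · omega
      rcases hr' with ⟨c, d, hcd, e1, e2⟩ | ⟨c, d, hcd, e1, e2⟩ | ⟨e1, e2⟩
      · have := d.2
        rw [diagram_adj_of_lt (by rw [Fin.lt_def]; omega)] at hcd
        rw [if_pos (by omega), e1, e2]
        exact mul_ne_zero (div_pos hn hN).ne' hcd
      · rw [diagram_adj_of_lt (by rw [Fin.lt_def]; omega)] at hcd
        have e3 : (b : ℕ) + 1 - N' = d + 1 := by omega
        have e4 : (a : ℕ) + 1 - N' = c + 1 := by omega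
        rw [if_neg (by omega), if_pos (by omega), e3, e4]
        exact mul_ne_zero (div_pos hN hp').ne' hcd
      · rw [if_neg (by omega), if_neg (by omega), if_pos ⟨e2, e1⟩]
        exact (div_pos hn hp').ne'
  ext a b
  rcases lt_trichotomy a b with hab | rfl | hab
  · exact key a b hab
  · simp only [SimpleGraph.irrefl]
  · rw [SimpleGraph.adj_comm, key b a hab, SimpleGraph.adj_comm]

end

theorem mainTheorem3 (N N' : ℕ) (hN'_pos : 1 ≤ N') (hN'_le : N' ≤ N - 1)
    (H₁ : HMatrix N') (H₂ : HMatrix (N - N'))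
    (hH₁ : H₁ ∈ optimalHMatrices.{u} N') (hH₂ : H₂ ∈ optimalHMatrices.{u} (N - N')) :
    (∃! H : HMatrix N, IsGluing N N' H₁ H₂ H) ∧
    ∀ H : HMatrix N, IsGluing N N' H₁ H₂ H →
      H ∈ optimalHMatrices.{u} N ∧
      (∀ k j : ℕ, 1 ≤ j → j < k → k ≤ N →
        cert N H k j = glueCert N N' (cert N' H₁) (cert (N - N') H₂) k j) ∧
      (IsVertex.{u} N' H₁ → IsVertex.{u} (N - N') H₂ →
        IsArcDiagram (diagram N' H₁) ∧ IsArcDiagram (diagram (N - N') H₂) ∧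
        IsVertex.{u} N H ∧ IsArcDiagram (diagram N H) ∧
        diagram N H = glueDiagram N N' (diagram N' H₁) (diagram (N - N') H₂)) := by
  have hle : N' < N := by omega
  refine ⟨⟨glueMatrix N N' H₁ H₂, isGluing_glueMatrix hN'_pos hle hH₂, fun H hH =>
    hH.unique (isGluing_glueMatrix hN'_pos hle hH₂) hN'_pos hle hH₁.1 hH₂⟩, fun H hH => ?_⟩
  have hopt : H ∈ optimalHMatrices.{u} N :=
    (hH.isCertified hN'_pos hle hH₁ hH₂).mem_optimal (by omega)
  refine ⟨hopt, hH.cert_eq hN'_pos hle hH₂, fun hv₁ hv₂ => ?_⟩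
  have hv : IsVertex.{u} N H := by
    refine (isVertex_iff (by omega)).2 ⟨hopt, ?_⟩
    have h := hH.card_certSupport_le hN'_pos hle hH₂
    have h1 := ((isVertex_iff hN'_pos).1 hv₁).2
    have h2 := ((isVertex_iff (by omega)).1 hv₂).2
    omega
  exact ⟨hv₁.isArcDiagram hN'_pos, hv₂.isArcDiagram (by omega), hv, hv.isArcDiagram (by omega),
    hH.diagram_eq hN'_pos hle hH₂⟩
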